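/- Let $d\in\mathbb N$, $T>0$, $\alpha\in[0,1]$. Let $W_L,W_F,W_C:\mathbb R^d\to\mathbb R$ and $\phi:\mathbb R^d\to[0,\infty)$ satisfy: (A1) $W_L,W_F,W_C$ are even, and $W_L$, $W_F$ are bounded below; (A2) $W_L,W_F,W_C\in C^2$ and $\nabla W_L,\nabla W_F,\nabla W_C\in \mathcal W^{1,\infty}$ (bounded and Lipschitz); (A3) $\phi\in C^1\cap \mathcal W^{1,\infty}$. *Particle system.* For $N,M\ge1$ and targets $x_{d_1},\dots,x_{d_N}\in\mathbb R^d$, a classical solution on $[0,T]$ consists of differentiable curves $(x_i,v_i)_{i\le N}$ (leaders) and $(y_i,w_i)_{i\le M}$ (followers) in $\mathbb R^d\times\mathbb R^d$ with $$\dot x_i=v_i,\qquad \dot v_i=-(1-\alpha)(x_i-x_{d_i})-\alpha\Big(x_i-\tfrac1M\sum_{j=1}^M y_j\Big)-v_i+\tfrac1N\sum_{j=1}^N\nabla W_L(x_j-x_i),$$ $$\dot y_i=w_i,\qquad \dot w_i=\tfrac1M\sum_{j=1}^M\nabla W_F(y_j-y_i)+\tfrac1N\sum_{j=1}^N\nabla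 W_C(x_j-y_i)+\tfrac1N\sum_{j=1}^N\phi(x_j-y_i)(v_j-w_i).$$ *Particle–fluid system.* For the same targets, a classical solution on $[0,T]$ consists of differentiable curves $(\bar x_i,\bar v_i)_{i\le N}$ and functions $\rho,u\in C^1([0,T]\times\mathbb R^d)$ with values in $\mathbb R$ and $\mathbb R^d$, where $\rho(t,\cdot)>0$ is a probability density for every $t$, such that, with $\bar\varrho_L=\frac1N\sum_i\delta_{\bar x_i}$, $$\dot{\bar x}_i=\bar v_i,\qquad \dot{\bar v}_i=-(1-\alpha)(\bar x_i-x_{d_i})-\alpha\Big(\bar x_i-\int z\,\rho(t,z)\,dz\Big)-\bar v_i-\nabla W_L*\bar\varrho_L(\bar x_i),$$ $$\partial_t\rho+\nabla\cdot(\rho u)=0,$$ $$\partial_t(\rho u)+\nabla\cdot(\rho u\otimes u)=-\rho\,\nabla W_F*\rho-\rho\,\nabla W_C*\bar\varrho_L+\rho\,\tfrac1N\sum_{j=1}^N\phi(\bar x_j-z)\,(\bar v_j-u(t,z)).$$ Assume further $\rho\in L^\infty(0,T;L^1_2)$, i.e. $\sup_t\int(1+|z|^2)\rho(t,z)\,dz<\infty$,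 and $u\in L^\infty(0,T;\mathcal W^{1,\infty})$. Given solutions of both systems, put $\mu_F(t)=\frac1M\sum_{i}\delta_{(y_i(t),w_i(t))}$, $\varrho_F(t)=\frac1M\sum_i\delta_{y_i(t)}$, $$L(t)=\frac1N\sum_{i=1}^N\big(|x_i(t)-\bar x_i(t)|^2+|v_i(t)-\bar v_i(t)|^2\big),$$ $$D(t)=d_1^2\big(\varrho_F(t),\rho(t)\big)+\iint|w-u(t,y)|^2\,\mu_F(t,dy\,dw)+L(t),$$ where $d_1$ is the first-order Wasserstein distance on $\mathbb R^d$. **(1) Quantitative estimate.** For every $K\ge0$ there is a constant $C>0$, depending only on $d,T,\alpha,W_L,W_F,W_C,\phi,K$ (in particular independent of $N$, of $M$ and of the solutions), such that $$D(t)\le C\,D(0)\qquad\text{for all }t\in[0,T]$$ for all $N,M\ge1$, all targets and all solutions as above for which $\int(1+|z|^2)\rho(t,z)\,dz\le K$, $\|u(t)\|_{L^\infty}\le K$ and $\mathrm{Lip}(u(t))\le K$ for all $t\in[0,T]$, and $\frac1N\sum_{i}(|x_{d_i}|^2+|\bar x_i(0)|^2+|\bar v_i(0)|^2)\le K$. **(2)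 Convergence.** Fix $N\ge1$, the targets and a solution $(\bar x,\bar v,\rho,u)$ as above, and for each $M\ge1$ let $(x^M,v^M,y^M,w^M)$ be a classical solution of the particle system with $M$ followers; write $\mu_F^M$, $L^M$, $D^M$ for the corresponding quantities. If $D^M(0)\to0$ as $M\to\infty$, then as $M\to\infty$: - $\sup_{0\le t\le T}L^M(t)\to0$; - $\frac1M\sum_i\delta_{y^M_i}\rightharpoonup\rho$ in $L^\infty(0,T;(C_b(\mathbb R^d))^*)$, in the sense that $\sup_{0\le t\le T}\big|\frac1M\sum_i\psi(y_i^M(t))-\int\psi\rho(t)\,dz\big|\to0$ for every $\psi\in C_b(\mathbb R^d)$; - $\frac1M\sum_iw_i^M\delta_{y^M_i}\to\rho u$ and $\frac1M\sum_iw_i^M\otimes w_i^M\,\delta_{y^M_i}\to\rho\,u\otimes u$ in $L^\infty(0,T;(\mathcal W^{1,\infty}(\mathbb R^d))^*)$, and $\mu_F^M\to\rho\,\delta_{u}$ (the image of $\rho(t)\,dz$ under $z\mapsto(z,u(t,z))$) in $L^\infty(0,T;(\mathcal W^{1,\infty}(\mathbb R^d\times\mathbb R^d))^*)$, i.e. uniformly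 in $t\in[0,T]$ and in test functions of $\mathcal W^{1,\infty}$-norm at most $1$. -/

import Mathlib

open MeasureTheory Set Filter
open scoped ENNReal NNReal Topology Gradient BoundedContinuousFunction

noncomputable section

namespace LeaderFollower

/-- Euclidean space `ℝ^d`, the state space of positions and of velocities. -/
abbrev Vec (d : ℕ) : Type := EuclideanSpace ℝ (Fin d)

/-- The data of the model: the control weight `α`, the interaction potentials `W_L`, `W_F`, `W_C`,
and the communication weight `φ`. -/
structure Model (d : ℕ) where
  α : ℝ
  WL : Vec d → ℝ
  WF : Vec d → ℝ
  WC : Vec d → ℝ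
  φ : Vec d → ℝ

/-- `W ∈ C²` with `∇W ∈ W^{1,∞}`, i.e. `∇W` is bounded and Lipschitz. -/
def RegularPotential {d : ℕ} (W : Vec d → ℝ) : Prop :=
  ContDiff ℝ 2 W ∧ ∃ K : ℝ≥0, (∀ x, ‖∇ W x‖ ≤ K) ∧ LipschitzWith K (∇ W)

/-- The standing assumptions on the model. -/
structure Model.Admissible {d : ℕ} (P : Model d) : Prop where
  α_mem : P.α ∈ Icc (0 : ℝ) 1
  φ_nonneg : ∀ x, 0 ≤ P.φ x
  -- (A1)
  WL_symm : ∀ x, P.WL x = P.WL (-x)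
  WF_symm : ∀ x, P.WF x = P.WF (-x)
  WC_symm : ∀ x, P.WC x = P.WC (-x)
  WL_bddBelow : BddBelow (range P.WL)
  WF_bddBelow : BddBelow (range P.WF)
  -- (A2)
  WL_regular : RegularPotential P.WL
  WF_regular : RegularPotential P.WF
  WC_regular : RegularPotential P.WC
  -- (A3)
  φ_contDiff : ContDiff ℝ 1 P.φ
  φ_sobolev : ∃ K : ℝ≥0, (∀ x, |P.φ x| ≤ K) ∧ LipschitzWith K P.φ

/-- The empirical measure `(1/n) ∑ᵢ δ_{zᵢ}`. -/
def empirical {X : Type*} [MeasurableSpace X] {n : ℕ} (z : Fin n → X) : Measure X :=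
  (n : ℝ≥0∞)⁻¹ • ∑ i, Measure.dirac (z i)

/-- The measure on `ℝ^d` with density `r` with respect to Lebesgue measure. -/
def densityMeasure {d : ℕ} (r : Vec d → ℝ) : Measure (Vec d) :=
  volume.withDensity fun x => ENNReal.ofReal (r x)

/-- The center of mass `⟨x⟩_μ = ∫ x μ(dx)`. -/
def centerOfMass {d : ℕ} (μ : Measure (Vec d)) : Vec d := ∫ z, z ∂μ

/-- The convolution `(∇W * μ)(x) = ∫ ∇W(x - y) μ(dy)`. -/
def gradConv {d : ℕ} (W : Vec d → ℝ) (μ : Measure (Vec d)) (x : Vec d) : Vec d :=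
  ∫ y, ∇ W (x - y) ∂μ

/-- The divergence `∑ᵢ ∂ᵢ Fᵢ` of a vector field. -/
def divergence {d : ℕ} (F : Vec d → Vec d) (x : Vec d) : ℝ :=
  ∑ i, (fderiv ℝ F x (EuclideanSpace.single i 1)) i

/-- Classical solutions on `[0,T]` of the leader-follower particle system with `N` leaders
`(xᵢ, vᵢ)` with targets `xdᵢ`, and `M` followers `(yᵢ, wᵢ)`. -/
structure IsParticleSolution {d : ℕ} (P : Model d) (T : ℝ) {N M : ℕ} (xd : Fin N → Vec d)
    (x v : Fin N → ℝ → Vec d) (y w : Fin M → ℝ → Vec d) : Prop where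
  x_deriv : ∀ t ∈ Icc 0 T, ∀ i, HasDerivWithinAt (x i) (v i t) (Icc 0 T) t
  v_deriv : ∀ t ∈ Icc 0 T, ∀ i, HasDerivWithinAt (v i)
    (-(1 - P.α) • (x i t - xd i)
      - P.α • (x i t - centerOfMass (empirical fun j => y j t))
      - v i t
      + (N : ℝ)⁻¹ • ∑ j, ∇ P.WL (x j t - x i t)) (Icc 0 T) t
  y_deriv : ∀ t ∈ Icc 0 T, ∀ i, HasDerivWithinAt (y i) (w i t) (Icc 0 T) t
  w_deriv : ∀ t ∈ Icc 0 T, ∀ i, HasDerivWithinAt (w i)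
    ((M : ℝ)⁻¹ • ∑ j, ∇ P.WF (y j t - y i t)
      + (N : ℝ)⁻¹ • ∑ j, ∇ P.WC (x j t - y i t)
      + (N : ℝ)⁻¹ • ∑ j, P.φ (x j t - y i t) • (v j t - w i t)) (Icc 0 T) t

/-- The force per unit mass acting on the follower fluid at the point `z`, where the fluid has
density `r` and velocity `u`, and the leaders have positions `x` and velocities `v`. -/
def fluidForce {d : ℕ} (P : Model d) {N : ℕ} (x v : Fin N → Vec d) (r : Vec d → ℝ)
    (u : Vec d → Vec d) (z : Vec d) : Vec d :=
  - gradConv P.WF (densityMeasure r) z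
    - gradConv P.WC (empirical x) z
    + ∫ p : Vec d × Vec d, P.φ (p.1 - z) • (p.2 - u z) ∂(empirical fun j => (x j, v j))

/-- Classical solutions on `[0,T]` of the particle-fluid system: `N` leaders `(xᵢ, vᵢ)` with
targets `xdᵢ`, coupled to a pressureless Euler system for the follower density `ρ` and velocity
`u`. At each time, `ρ` is a positive probability density. -/
structure IsParticleFluidSolution {d : ℕ} (P : Model d) (T : ℝ) {N : ℕ} (xd : Fin N → Vec d)
    (x v : Fin N → ℝ → Vec d) (ρ : ℝ → Vec d → ℝ) (u : ℝ → Vec d → Vec d) : Prop where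
  x_deriv : ∀ t ∈ Icc 0 T, ∀ i, HasDerivWithinAt (x i) (v i t) (Icc 0 T) t
  v_deriv : ∀ t ∈ Icc 0 T, ∀ i, HasDerivWithinAt (v i)
    (-(1 - P.α) • (x i t - xd i)
      - P.α • (x i t - centerOfMass (densityMeasure (ρ t)))
      - v i t
      - gradConv P.WL (empirical fun j => x j t) (x i t)) (Icc 0 T) t
  ρ_contDiff : ContDiffOn ℝ 1 (fun q : ℝ × Vec d => ρ q.1 q.2) (Icc 0 T ×ˢ univ)
  u_contDiff : ContDiffOn ℝ 1 (fun q : ℝ × Vec d => u q.1 q.2) (Icc 0 T ×ˢ univ)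
  ρ_pos : ∀ t ∈ Icc 0 T, ∀ z, 0 < ρ t z
  ρ_prob : ∀ t ∈ Icc 0 T, IsProbabilityMeasure (densityMeasure (ρ t))
  continuity_eq : ∀ t ∈ Icc 0 T, ∀ z,
    derivWithin (fun s => ρ s z) (Icc 0 T) t
      + divergence (fun z' => ρ t z' • u t z') z = 0
  momentum_eq : ∀ t ∈ Icc 0 T, ∀ z, ∀ k,
    derivWithin (fun s => ρ s z * u s z k) (Icc 0 T) t
      + divergence (fun z' => (ρ t z' * u t z' k) • u t z') z
      = ρ t z * fluidForce P (fun j => x j t) (fun j => v j t) (ρ t) (u t) z k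

/-- `‖ρ‖_{L^∞(0,T; L^1_2)} ≤ K`, for nonnegative `ρ` that is continuous in time (for which the
essential supremum over `t` is a supremum). -/
def DensityBound {d : ℕ} (T : ℝ) (K : ℝ≥0) (ρ : ℝ → Vec d → ℝ) : Prop :=
  ∀ t ∈ Icc 0 T, ∫⁻ z, ENNReal.ofReal ((1 + ‖z‖ ^ 2) * ρ t z) ≤ K

/-- `‖u‖_{L^∞(0,T; W^{1,∞})} ≤ K`, for continuous `u`. -/
def VelocityBound {d : ℕ} (T : ℝ) (K : ℝ≥0) (u : ℝ → Vec d → Vec d) : Prop :=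
  ∀ t ∈ Icc 0 T, (∀ z, ‖u t z‖ ≤ K) ∧ LipschitzWith K (u t)

/-- The first-order Wasserstein distance: the infimum of `∫ |a - b| γ(da db)` over all couplings
`γ` of `μ` and `ν`. -/
def wasserstein1 {d : ℕ} (μ ν : Measure (Vec d)) : ℝ≥0∞ :=
  ⨅ γ : {γ : Measure (Vec d × Vec d) // γ.map Prod.fst = μ ∧ γ.map Prod.snd = ν},
    ∫⁻ p, edist p.1 p.2 ∂γ.1

/-- The empirical measure `μ_F` of the followers in phase space, at time `t`. -/
def followerMeasure {d M : ℕ} (y w : Fin M → ℝ → Vec d) (t : ℝ) : Measure (Vec d × Vec d) :=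
  empirical fun i => (y i t, w i t)

/-- The leader discrepancy `∫ (|x - x̄|² + |v - v̄|²) π_L(t, dx dv dx̄ dv̄)`, where `π_L` is the
empirical coupling of the leaders of the two systems. -/
def leaderDiscrepancy {d N : ℕ} (x v x' v' : Fin N → ℝ → Vec d) (t : ℝ) : ℝ≥0∞ :=
  ∫⁻ p : (Vec d × Vec d) × (Vec d × Vec d), ‖p.1.1 - p.2.1‖ₑ ^ 2 + ‖p.1.2 - p.2.2‖ₑ ^ 2
    ∂(empirical fun i => ((x i t, v i t), (x' i t, v' i t)))

/-- The total discrepancy at time `t` between a solution `(x, v, y, w)` of the particle system and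
a solution `(x', v', ρ, u)` of the particle-fluid system. -/
def discrepancy {d N M : ℕ} (x v : Fin N → ℝ → Vec d) (y w : Fin M → ℝ → Vec d)
    (x' v' : Fin N → ℝ → Vec d) (ρ : ℝ → Vec d → ℝ) (u : ℝ → Vec d → Vec d) (t : ℝ) : ℝ≥0∞ :=
  wasserstein1 ((followerMeasure y w t).map Prod.fst) (densityMeasure (ρ t)) ^ 2
    + ∫⁻ p, ‖p.2 - u t p.1‖ₑ ^ 2 ∂(followerMeasure y w t)
    + leaderDiscrepancy x v x' v' t

/-- The unit ball of `W^{1,∞}(X)`: functions bounded by `1` and Lipschitz with constant `1`.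
(On `ℝ^d × ℝ^d` the Lipschitz condition refers to the maximum metric of the product, which only
replaces the norm of `W^{1,∞}` by an equivalent one.) -/
def lipBall (X : Type*) [PseudoEMetricSpace X] : Set (X → ℝ) :=
  {ψ | (∀ a, |ψ a| ≤ 1) ∧ LipschitzWith 1 ψ}

end LeaderFollower

end

/-! The fluid is carried by its characteristics. Let η be the flow of u. The continuity equation and
Liouville's formula make ρ times the Jacobian of η constant along characteristics, so ρ(t) is the
image of ρ(0) under η(·,t) (`IsParticleFluidSolution.map_flow`). A coupling of followers and fluid
at time 0 can therefore be carried along to time t. Comparing y_i(t) with the characteristic issued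
from y_i(0) gives d₁(ϱ_F(t), ρ(t)) ≤ (1/M) ∑ |y_i(t) - η(y_i(0), t)| + exp(κT) a, with a =
d₁(ϱ_F(0), ρ(0)) (`IsParticleFluidSolution.wasserstein1_le`). The Wasserstein distance itself is
never differentiated in time.

Let B, E, X, V be the mean squares of y_i - η(y_i(0), t), w_i - u(t, y_i), x_i - x̄_i and v_i -
v̄_i. Since ρ > 0, the momentum equation reduces to ∂ₜu + Du u = force, so the derivative of w_i -
u(t, y_i) is a difference of forces minus Du (w_i - u). The interaction forces are Lipschitz, hence
their differences are controlled by the errors and by d₁. One term contains the velocities v̄_j,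
which have no individual bound; Cauchy-Schwarz and an a priori bound on their mean square
(`IsParticleFluidSolution.avg_leader_velocity_le`) handle it. Thus B + E + X + V + a² satisfies a
homogeneous Grönwall inequality whose rate does not involve N or M (`IsParticleSolution.stability`),
and B vanishes at time 0.

For the convergence, D tends to 0 uniformly in time. An observable is first moved from w_i to u(t,
y_i), at a cost controlled by E, and then from ϱ_F to ρ, at a cost controlled by d₁
(`norm_integral_observable_sub_le`). Test functions that are only bounded and continuous are handled
with the second moment of ρ (`exists_abs_sub_le`). -/

noncomputable section

namespace LeaderFollower

/-! ### Ordinary differential equations and Grönwall inequalities on a closed interval -/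

section ODE

variable {E : Type*} [NormedAddCommGroup E] [NormedSpace ℝ E]

/-- Global existence on `[0, T]` for a bounded Lipschitz time-dependent vector field. -/
lemma exists_integralCurve_of_bounded_lipschitz [CompleteSpace E] {f : ℝ → E → E} {T : ℝ}
    (hT : 0 ≤ T) {K L : ℝ≥0} (hlip : ∀ t ∈ Icc 0 T, LipschitzWith K (f t))
    (hcont : ∀ x, ContinuousOn (fun t => f t x) (Icc 0 T))
    (hb : ∀ t ∈ Icc 0 T, ∀ x, ‖f t x‖ ≤ L) (x₀ : E) :
    ∃ α : ℝ → E, α 0 = x₀ ∧ ∀ t ∈ Icc 0 T, HasDerivWithinAt α (f t (α t)) (Icc 0 T) t := by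
  have hp : IsPicardLindelof f (tmin := 0) (tmax := T) ⟨0, left_mem_Icc.2 hT⟩ x₀
      (L * T.toNNReal) 0 L K :=
    { lipschitzOnWith := fun t ht => (hlip t ht).lipschitzOnWith
      continuousOn := fun x _ => hcont x
      norm_le := fun t ht x _ => hb t ht x
      mul_max_le := by simp [hT] }
  exact hp.exists_eq_forall_mem_Icc_hasDerivWithinAt₀

lemma hasDerivWithinAt_Ici_of_Icc {f : ℝ → E} {f' : E} {T t : ℝ}
    (h : HasDerivWithinAt f f' (Icc 0 T) t) (ht : t ∈ Ico 0 T) :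
    HasDerivWithinAt f f' (Ici t) t :=
  (h.mono (Icc_subset_Icc_left ht.1)).mono_of_mem_nhdsWithin (Icc_mem_nhdsGE ht.2)

/-- Grönwall's inequality for curves that are differentiable on a closed interval. -/
lemma norm_le_gronwallBound_of_hasDerivWithinAt {f f' : ℝ → E} {T δ K ε : ℝ}
    (hf : ∀ t ∈ Icc 0 T, HasDerivWithinAt f (f' t) (Icc 0 T) t) (h0 : ‖f 0‖ ≤ δ)
    (hb : ∀ t ∈ Icc 0 T, ‖f' t‖ ≤ K * ‖f t‖ + ε) {t : ℝ} (ht : t ∈ Icc 0 T) :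
    ‖f t‖ ≤ gronwallBound δ K ε t := by
  have := norm_le_gronwallBound_of_norm_deriv_right_le (f := f) (f' := f') (δ := δ) (K := K)
    (ε := ε) (a := 0) (b := T) (fun s hs => (hf s hs).continuousWithinAt)
    (fun s hs => hasDerivWithinAt_Ici_of_Icc (hf s (Ico_subset_Icc_self hs)) hs) h0
    (fun s hs => hb s (Ico_subset_Icc_self hs)) t ht
  simpa using this

/-- The differential form of Grönwall's inequality. -/
lemma le_mul_exp_of_hasDerivWithinAt {f f' : ℝ → ℝ} {T C : ℝ}
    (hf : ∀ t ∈ Icc 0 T, HasDerivWithinAt f (f' t) (Icc 0 T) t)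
    (hb : ∀ t ∈ Icc 0 T, f' t ≤ C * f t) {t : ℝ} (ht : t ∈ Icc 0 T) :
    f t ≤ f 0 * Real.exp (C * t) := by
  have := le_gronwallBound_of_liminf_deriv_right_le (f := f) (f' := f') (δ := f 0) (K := C)
    (ε := 0) (a := 0) (b := T) (fun s hs => (hf s hs).continuousWithinAt)
    (fun s hs r hr =>
      (hasDerivWithinAt_Ici_of_Icc (hf s (Ico_subset_Icc_self hs)) hs).liminf_right_slope_le hr)
    le_rfl
    (fun s hs => by simpa using hb s (Ico_subset_Icc_self hs)) t ht
  simpa [gronwallBound_ε0] using this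

/-- Linear differential equations with continuous coefficients have global solutions. -/
lemma exists_linear_integralCurve [FiniteDimensional ℝ E] {A : ℝ → E →L[ℝ] E} {T : ℝ}
    (hT : 0 ≤ T) (hA : ContinuousOn A (Icc 0 T)) (x₀ : E) :
    ∃ α : ℝ → E, α 0 = x₀ ∧ ∀ t ∈ Icc 0 T, HasDerivWithinAt α (A t (α t)) (Icc 0 T) t := by
  have : CompleteSpace E := FiniteDimensional.complete ℝ E
  obtain ⟨K, hK⟩ := isCompact_Icc.exists_bound_of_continuousOn hA
  have hK0 : 0 ≤ K := (norm_nonneg _).trans (hK 0 (left_mem_Icc.2 hT))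
  set R : ℝ := ‖x₀‖ * Real.exp (K * T) + 1 with hR
  have hRpos : 0 < R := by positivity
  let χ : ContDiffBump (0 : E) := ⟨R, R + 1, hRpos, by linarith⟩
  let g : E → E := fun x => χ x • x
  have hg1 : ContDiff ℝ 1 g := χ.contDiff.smul contDiff_id
  have hgc : HasCompactSupport g := χ.hasCompactSupport.smul_right
  obtain ⟨C, hC⟩ := hg1.lipschitzWith_of_hasCompactSupport hgc one_ne_zero
  obtain ⟨B, hB⟩ := hgc.exists_bound_of_continuous hg1.continuous
  have hgle : ∀ x, ‖g x‖ ≤ ‖x‖ := fun x => by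
    simp only [g, norm_smul, Real.norm_eq_abs, abs_of_nonneg χ.nonneg]
    exact mul_le_of_le_one_left (norm_nonneg _) χ.le_one
  have hB0 : 0 ≤ B := (norm_nonneg _).trans (hB 0)
  obtain ⟨α, hα0, hα⟩ := exists_integralCurve_of_bounded_lipschitz (f := fun t x => A t (g x)) hT
    (K := ⟨K, hK0⟩ * C) (L := ⟨K * B, by positivity⟩)
    (fun t ht => ((A t).lipschitz.weaken (by exact_mod_cast hK t ht)).comp hC)
    (fun x => hA.clm_apply continuousOn_const)
    (fun t ht x => (((A t).le_opNorm _).trans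
      (mul_le_mul (hK t ht) (hB x) (norm_nonneg _) hK0))) x₀
  refine ⟨α, hα0, fun t ht => ?_⟩
  -- The cut-off does not increase norms, so the a priori bound also holds for the truncated
  -- equation. The curve never meets the cut-off region.
  have hbound : ‖α t‖ ≤ R := by
    have := norm_le_gronwallBound_of_hasDerivWithinAt (δ := ‖x₀‖) (K := K) (ε := 0) hα
      (by rw [hα0]) (fun s hs => by
        rw [add_zero]
        exact ((A s).le_opNorm _).trans (mul_le_mul (hK s hs) (hgle _) (norm_nonneg _) hK0)) ht
    rw [gronwallBound_ε0] at this
    have h2 : ‖x₀‖ * Real.exp (K * t) ≤ ‖x₀‖ * Real.exp (K * T) := by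
      gcongr
      exact ht.2
    linarith
  have : g (α t) = α t := by
    have : χ (α t) = 1 := χ.one_of_mem_closedBall (by simpa [χ] using hbound)
    simp [g, this]
  simpa [this] using hα t ht

end ODE

/-! ### Calculus of functions that are C¹ on the slab [0, T] × E -/

section TimeDependent

variable {E F : Type*} [NormedAddCommGroup E] [NormedSpace ℝ E] [NormedAddCommGroup F]
  [NormedSpace ℝ F] {T : ℝ} {f : ℝ → E → F}

lemma uniqueDiffOn_Icc_prod_univ (hT : 0 < T) :
    UniqueDiffOn ℝ (Icc 0 T ×ˢ (univ : Set E)) :=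
  (uniqueDiffOn_Icc hT).prod uniqueDiffOn_univ

/-- The slice at time t lies in the slab even when t is an end point, so the derivative in space is
two-sided although the one in time may not be. -/
lemma hasFDerivAt_space_of_contDiffOn
    (hf : ContDiffOn ℝ 1 (fun q : ℝ × E => f q.1 q.2) (Icc 0 T ×ˢ univ)) {t : ℝ}
    (ht : t ∈ Icc 0 T) (z : E) :
    HasFDerivAt (f t) ((fderivWithin ℝ (fun q : ℝ × E => f q.1 q.2) (Icc 0 T ×ˢ univ) (t, z)).comp
      (ContinuousLinearMap.inr ℝ ℝ E)) z := by
  have h := (hf.differentiableOn one_ne_zero (t, z) ⟨ht, mem_univ z⟩).hasFDerivWithinAt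
  have h2 : HasFDerivWithinAt (fun z' : E => (t, z')) (ContinuousLinearMap.inr ℝ ℝ E) univ z :=
    (hasFDerivAt_prodMk_right t z).hasFDerivWithinAt
  exact hasFDerivWithinAt_univ.1 (h.comp z h2 (fun z' _ => ⟨ht, mem_univ z'⟩))

lemma continuousOn_fderiv_space (hT : 0 < T)
    (hf : ContDiffOn ℝ 1 (fun q : ℝ × E => f q.1 q.2) (Icc 0 T ×ˢ univ)) :
    ContinuousOn (fun q : ℝ × E => fderiv ℝ (f q.1) q.2) (Icc 0 T ×ˢ univ) := by
  have h := hf.continuousOn_fderivWithin (uniqueDiffOn_Icc_prod_univ hT) le_rfl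
  refine (h.clm_comp (continuousOn_const (c := ContinuousLinearMap.inr ℝ ℝ E))).congr ?_
  rintro ⟨t, z⟩ ⟨ht, -⟩
  exact (hasFDerivAt_space_of_contDiffOn hf ht z).fderiv

/-- The chain rule for a time-dependent function along a curve. -/
lemma hasDerivWithinAt_along_curve (hT : 0 < T)
    (hf : ContDiffOn ℝ 1 (fun q : ℝ × E => f q.1 q.2) (Icc 0 T ×ˢ univ)) {t : ℝ}
    (ht : t ∈ Icc 0 T) {γ : ℝ → E} {γ' : E} (hγ : HasDerivWithinAt γ γ' (Icc 0 T) t) :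
    HasDerivWithinAt (fun s => f s (γ s))
      (derivWithin (fun s => f s (γ t)) (Icc 0 T) t + fderiv ℝ (f t) (γ t) γ') (Icc 0 T) t := by
  set D := fderivWithin ℝ (fun q : ℝ × E => f q.1 q.2) (Icc 0 T ×ˢ univ) (t, γ t) with hD
  have h : HasFDerivWithinAt (fun q : ℝ × E => f q.1 q.2) D (Icc 0 T ×ˢ univ) (t, γ t) :=
    (hf.differentiableOn one_ne_zero (t, γ t) ⟨ht, mem_univ _⟩).hasFDerivWithinAt
  -- Used twice: the constant curve identifies the partial time derivative with D(1, 0), and γ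
  -- itself gives D(1, γ').
  have key : ∀ {c : ℝ → E} {c' : E}, c t = γ t → HasDerivWithinAt c c' (Icc 0 T) t →
      HasDerivWithinAt (fun s => f s (c s)) (D (1, c')) (Icc 0 T) t := by
    intro c c' hc hc'
    have h' : HasFDerivWithinAt (fun q : ℝ × E => f q.1 q.2) D (Icc 0 T ×ˢ univ) (t, c t) := by
      rw [hc]
      exact h
    exact HasFDerivWithinAt.comp_hasDerivWithinAt (f := fun s => (s, c s)) t h'
      ((hasDerivWithinAt_id t _).prodMk hc') (fun s hs => mk_mem_prod hs (mem_univ _))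
  have h1 := (key (c := fun _ => γ t) rfl (hasDerivWithinAt_const t _ _)).derivWithin
    (uniqueDiffOn_Icc hT t ht)
  have h2 := (hasFDerivAt_space_of_contDiffOn hf ht (γ t)).fderiv
  rw [h1, h2]
  have : D (1, (0 : E)) + (D.comp (ContinuousLinearMap.inr ℝ ℝ E)) γ' = D (1, γ') := by
    simp [← map_add]
  rw [this]
  exact key rfl hγ

end TimeDependent

/-! ### The flow of a velocity field, its derivative and Liouville's formula -/

section Flow

/-- If `D` is continuous on `[0, T] × E`, it is uniformly continuous near a compact curve. -/
lemma exists_uniform_dist_le {E F : Type*} [NormedAddCommGroup E]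
    [NormedAddCommGroup F] {T : ℝ} (hT : 0 ≤ T) {D : ℝ → E → F}
    (hD : ContinuousOn (fun q : ℝ × E => D q.1 q.2) (Icc 0 T ×ˢ univ)) {γ : ℝ → E}
    (hγ : ContinuousOn γ (Icc 0 T)) {ε : ℝ} (hε : 0 < ε) :
    ∃ δ > 0, ∀ t ∈ Icc 0 T, ∀ x, ‖x - γ t‖ < δ → ‖D t x - D t (γ t)‖ ≤ ε := by
  -- Time is projected onto [0, T] so that G is continuous everywhere and compactness of the graph
  -- of γ applies.
  let G : ℝ × E → F := fun q => D (projIcc 0 T hT q.1) q.2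
  have hG : Continuous G := by
    have : Continuous fun q : ℝ × E => (((projIcc 0 T hT q.1 : Icc 0 T) : ℝ), q.2) := by fun_prop
    exact hD.comp_continuous this fun q => ⟨(projIcc 0 T hT q.1).2, mem_univ _⟩
  have hK : IsCompact ((fun t => (t, γ t)) '' Icc 0 T) :=
    isCompact_Icc.image_of_continuousOn (continuousOn_id.prodMk hγ)
  have h := hK.uniformContinuousAt_of_continuousAt G (fun _ _ => hG.continuousAt)
    (Metric.dist_mem_uniformity hε)
  obtain ⟨δ, hδ, H⟩ := Metric.mem_uniformity_dist.1 h
  refine ⟨δ, hδ, fun t ht x hx => ?_⟩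
  have h1 : dist (t, γ t) (t, x) < δ := by
    rw [Prod.dist_eq]
    simpa [hδ, dist_comm (γ t) x, dist_eq_norm] using hx
  have h2 := H h1 (mem_image_of_mem _ ht)
  simp only [G, projIcc_of_mem hT ht, mem_ofPred_eq] at h2
  rw [dist_comm, dist_eq_norm] at h2
  exact h2.le

variable {E : Type*} [NormedAddCommGroup E] [NormedSpace ℝ E]

/-- `η z` is the characteristic on `[0, T]` of the velocity field `u` that starts at `z`. -/
structure IsFlow (T : ℝ) (u : ℝ → E → E) (η : E → ℝ → E) : Prop where
  initial : ∀ z, η z 0 = z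
  deriv : ∀ z, ∀ t ∈ Icc 0 T, HasDerivWithinAt (η z) (u t (η z t)) (Icc 0 T) t

variable {T : ℝ} {u : ℝ → E → E} {η : E → ℝ → E} {K : ℝ≥0}

lemma IsFlow.norm_sub_le (hη : IsFlow T u η) (hu : ∀ t ∈ Icc 0 T, LipschitzWith K (u t))
    (z z' : E) {t : ℝ} (ht : t ∈ Icc 0 T) :
    ‖η z t - η z' t‖ ≤ ‖z - z'‖ * Real.exp (K * t) := by
  have := norm_le_gronwallBound_of_hasDerivWithinAt (f := fun s => η z s - η z' s)
    (δ := ‖z - z'‖) (K := K) (ε := 0)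
    (fun s hs => (hη.deriv z s hs).sub (hη.deriv z' s hs)) (by simp [hη.initial])
    (fun s hs => by simpa using (hu s hs).norm_sub_le _ _) ht
  simpa [gronwallBound_ε0] using this

/-- Uniqueness backwards in time: characteristics that meet at time t agree down to time 0, where
they are their initial data. -/
lemma IsFlow.injective (hη : IsFlow T u η) (hu : ∀ t ∈ Icc 0 T, LipschitzWith K (u t))
    {t : ℝ} (ht : t ∈ Icc 0 T) : Function.Injective fun z => η z t := by
  intro z z' h
  have hsub : Icc 0 t ⊆ Icc 0 T := Icc_subset_Icc_right ht.2
  have key : ∀ z, ∀ s ∈ Ioc 0 t, HasDerivWithinAt (η z) (u s (η z s)) (Iic s) s := fun z s hs =>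
    ((hη.deriv z s (hsub (Ioc_subset_Icc_self hs))).mono
      (Icc_subset_Icc_right (hs.2.trans ht.2))).mono_of_mem_nhdsWithin (Icc_mem_nhdsLE hs.1)
  have hc : ∀ z, ContinuousOn (η z) (Icc 0 t) := fun z s hs =>
    ((hη.deriv z s (hsub hs)).continuousWithinAt).mono hsub
  have := ODE_solution_unique_of_mem_Icc_left (s := fun _ => univ) (K := K)
    (fun s hs => (hu s (hsub (Ioc_subset_Icc_self hs))).lipschitzOnWith) (hc z) (key z)
    (fun _ _ => mem_univ _) (hc z') (key z') (fun _ _ => mem_univ _) h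
  simpa [hη.initial] using this (left_mem_Icc.2 ht.1)

/-- The flow of a `C¹` velocity field is differentiable in the initial datum, and its derivative
solves the linearized equation. -/
lemma IsFlow.exists_hasFDerivAt [FiniteDimensional ℝ E] (hT : 0 < T) (hη : IsFlow T u η)
    (hu : ∀ t ∈ Icc 0 T, LipschitzWith K (u t))
    (hC : ContDiffOn ℝ 1 (fun q : ℝ × E => u q.1 q.2) (Icc 0 T ×ˢ univ)) (z : E) :
    ∃ J : ℝ → E →L[ℝ] E, J 0 = ContinuousLinearMap.id ℝ E ∧
      (∀ t ∈ Icc 0 T, HasDerivWithinAt J ((fderiv ℝ (u t) (η z t)).comp (J t)) (Icc 0 T) t) ∧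
      ∀ t ∈ Icc 0 T, HasFDerivAt (fun z' => η z' t) (J t) z := by
  have hcont : ContinuousOn (η z) (Icc 0 T) := fun s hs => (hη.deriv z s hs).continuousWithinAt
  have hA : ContinuousOn (fun t => fderiv ℝ (u t) (η z t)) (Icc 0 T) :=
    (continuousOn_fderiv_space hT hC).comp (continuousOn_id.prodMk hcont)
      (fun t ht => mk_mem_prod ht (mem_univ _))
  -- The variational equation is solved first, as a linear equation in the space of operators; its
  -- solution is then shown to be the derivative of the flow.
  obtain ⟨J, hJ0, hJ⟩ := exists_linear_integralCurve hT.le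
    (A := fun t => ContinuousLinearMap.compL ℝ E E E (fderiv ℝ (u t) (η z t)))
    ((ContinuousLinearMap.compL ℝ E E E).continuous.comp_continuousOn hA)
    (ContinuousLinearMap.id ℝ E)
  refine ⟨J, hJ0, hJ, fun t ht => ?_⟩
  have hdiff : ∀ s ∈ Icc 0 T, ∀ x, DifferentiableAt ℝ (u s) x := fun s hs x =>
    (hasFDerivAt_space_of_contDiffOn hC hs x).differentiableAt
  have hAK : ∀ s ∈ Icc 0 T, ‖fderiv ℝ (u s) (η z s)‖ ≤ K := fun s hs =>
    norm_fderiv_le_of_lipschitz ℝ (hu s hs)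
  rw [hasFDerivAt_iff_isLittleO_nhds_zero, Asymptotics.isLittleO_iff]
  intro c hc
  set B : ℝ := Real.exp (K * T) * Real.exp ((K + 1) * T) with hB
  have hB0 : 0 < B := by positivity
  obtain ⟨δ, hδ, H⟩ := exists_uniform_dist_le (D := fun s x => fderiv ℝ (u s) x) hT.le
    (continuousOn_fderiv_space hT hC) hcont (ε := c / B) (by positivity)
  have hδ' : 0 < δ / Real.exp (K * T) := by positivity
  filter_upwards [Metric.ball_mem_nhds (0 : E) hδ'] with h hh
  rw [mem_ball_zero_iff, lt_div_iff₀ (Real.exp_pos _)] at hh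
  have hflow : ∀ s ∈ Icc 0 T, ‖η (z + h) s - η z s‖ ≤ ‖h‖ * Real.exp (K * T) := fun s hs => by
    have := hη.norm_sub_le hu (z + h) z hs
    rw [add_sub_cancel_left] at this
    refine this.trans ?_
    gcongr
    exact hs.2
  have hrem : ∀ s ∈ Icc 0 T, ‖u s (η (z + h) s) - u s (η z s)
      - fderiv ℝ (u s) (η z s) (η (z + h) s - η z s)‖ ≤ c / B * (‖h‖ * Real.exp (K * T)) := by
    intro s hs
    refine ((convex_ball (η z s) δ).norm_image_sub_le_of_norm_fderiv_le'
      (fun x _ => hdiff s hs x) (fun x hx => H s hs x (mem_ball_iff_norm.1 hx))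
      (Metric.mem_ball_self hδ)
      (mem_ball_iff_norm.2 ((hflow s hs).trans_lt hh))).trans ?_
    gcongr
    exact hflow s hs
  -- The defect solves the linearized equation with the Taylor remainder as source. The rate K + 1
  -- in place of K is nonzero, and dividing by it does no harm since it is at least 1.
  have hmain := norm_le_gronwallBound_of_hasDerivWithinAt
    (f := fun s => η (z + h) s - η z s - J s h)
    (δ := 0) (K := K + 1) (ε := c / B * (‖h‖ * Real.exp (K * T)))
    (fun s hs => ((hη.deriv (z + h) s hs).sub (hη.deriv z s hs)).sub
      ((hJ s hs).clm_apply (hasDerivWithinAt_const s _ h)))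
    (by simp [hη.initial, hJ0]) (fun s hs => by
      have h1 : u s (η (z + h) s) - u s (η z s)
          - ((ContinuousLinearMap.compL ℝ E E E (fderiv ℝ (u s) (η z s))) (J s) h + J s 0) =
          fderiv ℝ (u s) (η z s) (η (z + h) s - η z s - J s h) +
          (u s (η (z + h) s) - u s (η z s)
            - fderiv ℝ (u s) (η z s) (η (z + h) s - η z s)) := by
        simp only [ContinuousLinearMap.compL_apply, ContinuousLinearMap.comp_apply, map_sub,
          map_zero]
        abel
      rw [h1]
      refine (norm_add_le _ _).trans (add_le_add ?_ (hrem s hs))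
      refine (ContinuousLinearMap.le_opNorm _ _).trans ?_
      gcongr
      linarith [hAK s hs]) ht
  refine hmain.trans ?_
  have hK1 : (0 : ℝ) < K + 1 := by positivity
  rw [gronwallBound_of_K_ne_0 hK1.ne']
  have hexp : Real.exp ((K + 1) * t) - 1 ≤ Real.exp ((K + 1) * T) := by
    have : Real.exp ((K + 1) * t) ≤ Real.exp ((K + 1) * T) := by
      gcongr
      exact ht.2
    linarith
  have hε : 0 ≤ c / B * (‖h‖ * Real.exp (K * T)) := by positivity
  calc 0 * Real.exp ((K + 1) * t) + c / B * (‖h‖ * Real.exp (K * T)) / (K + 1)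
        * (Real.exp ((K + 1) * t) - 1)
      ≤ c / B * (‖h‖ * Real.exp (K * T)) * Real.exp ((K + 1) * T) := by
        rw [zero_mul, zero_add]
        refine mul_le_mul (div_le_self hε (by linarith [K.coe_nonneg])) hexp ?_ hε
        exact sub_nonneg.2 (Real.one_le_exp (mul_nonneg hK1.le ht.1))
    _ = c * ‖h‖ := by
        rw [hB]
        field_simp

/-- The determinant is 1 + r tr A + r² p(r) with p a polynomial. -/
lemma hasDerivAt_det_one_add_smul {n : Type*} [Fintype n] [DecidableEq n] (A : Matrix n n ℝ) :
    HasDerivAt (fun r : ℝ => (1 + r • A).det) A.trace 0 := by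
  let p := (Matrix.det (1 + (Polynomial.X : Polynomial ℝ) • A.map Polynomial.C)).divX.divX
  have h : HasDerivAt (fun r : ℝ => 1 + A.trace * r + p.eval r * r ^ 2)
      (A.trace * 1 + (p.derivative.eval 0 * 0 ^ 2 + p.eval 0 * (((2 : ℕ) : ℝ) * 0 ^ 1))) 0 := by
    have h1 := ((hasDerivAt_id (0 : ℝ)).const_mul A.trace).const_add 1
    exact h1.add ((p.hasDerivAt 0).mul (hasDerivAt_pow 2 0))
  rw [funext fun r => Matrix.det_one_add_smul r A]
  simpa using h

/-- Liouville's formula: a solution of `M' = A M` satisfies `(det M)' = tr A det M`. -/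
lemma hasDerivWithinAt_det {n : Type*} [Fintype n] [DecidableEq n] {M : ℝ → Matrix n n ℝ}
    {A : Matrix n n ℝ} {s : Set ℝ} {t : ℝ}
    (hM : ∀ i j, HasDerivWithinAt (fun r => M r i j) ((A * M t) i j) s t) :
    HasDerivWithinAt (fun r => (M r).det) (A.trace * (M t).det) s t := by
  have hdet : Differentiable ℝ fun X : n → n → ℝ => (Matrix.of X).det := by
    simp only [Matrix.det_apply, Matrix.of_apply]
    fun_prop
  let m : n → n → ℝ := M t
  let B : n → n → ℝ := A * M t
  have hM' : HasDerivWithinAt (fun r => (fun i j => M r i j)) B s t :=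
    hasDerivWithinAt_pi.2 fun i => hasDerivWithinAt_pi.2 fun j => hM i j
  have h1 := (hdet m).hasFDerivAt.comp_hasDerivWithinAt t hM'
  -- The derivative of det at M in the direction AM can be read off on the line M + rAM, where det
  -- equals det(1 + rA) det M.
  have h2 : HasDerivAt (fun r : ℝ => m + r • B) B 0 := by
    simpa using ((hasDerivAt_id (0 : ℝ)).smul_const B).const_add m
  have h3 : HasFDerivAt (fun X : n → n → ℝ => (Matrix.of X).det)
      (fderiv ℝ (fun X : n → n → ℝ => (Matrix.of X).det) m) (m + (0 : ℝ) • B) := by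
    simpa using (hdet m).hasFDerivAt
  have h4 := HasFDerivAt.comp_hasDerivAt (0 : ℝ) h3 h2
  have h5 : HasDerivAt (fun r : ℝ => (1 + r • A).det * (M t).det) (A.trace * (M t).det) 0 :=
    (hasDerivAt_det_one_add_smul A).mul_const _
  have h6 : (fun r : ℝ => (1 + r • A).det * (M t).det) =
      (fun X : n → n → ℝ => (Matrix.of X).det) ∘ fun r : ℝ => m + r • B := by
    ext r
    rw [← Matrix.det_mul, add_mul, one_mul, Matrix.smul_mul]
    rfl
  rw [h6] at h5
  rw [← h4.unique h5]
  exact h1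

end Flow

/-! ### Divergence as a trace, and the Jacobian of the flow -/

section Transport

variable {d : ℕ} {T : ℝ} {u : ℝ → Vec d → Vec d} {η : Vec d → ℝ → Vec d} {K : ℝ≥0}

lemma divergence_eq_trace (F : Vec d → Vec d) (z : Vec d) :
    divergence F z = (LinearMap.toMatrix (EuclideanSpace.basisFun (Fin d) ℝ).toBasis
      (EuclideanSpace.basisFun (Fin d) ℝ).toBasis (fderiv ℝ F z : Vec d →ₗ[ℝ] Vec d)).trace := by
  simp [divergence, Matrix.trace, LinearMap.toMatrix_apply]

lemma hasDerivWithinAt_det_clm {J : ℝ → Vec d →L[ℝ] Vec d} {A : Vec d →L[ℝ] Vec d} {s : Set ℝ}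
    {t : ℝ} (hJ : HasDerivWithinAt J (A.comp (J t)) s t) :
    HasDerivWithinAt (fun r => (J r).det)
      ((LinearMap.toMatrix (EuclideanSpace.basisFun (Fin d) ℝ).toBasis
        (EuclideanSpace.basisFun (Fin d) ℝ).toBasis (A : Vec d →ₗ[ℝ] Vec d)).trace * (J t).det)
      s t := by
  set b := (EuclideanSpace.basisFun (Fin d) ℝ).toBasis with hb
  simp only [ContinuousLinearMap.det, ← LinearMap.det_toMatrix b]
  refine hasDerivWithinAt_det fun i j => ?_
  rw [← LinearMap.toMatrix_comp]
  have h := hJ.clm_apply (hasDerivWithinAt_const t s (b j))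
  have h2 := ((EuclideanSpace.proj i : Vec d →L[ℝ] ℝ).hasFDerivAt
    (x := J t (b j))).comp_hasDerivWithinAt t h
  simpa [LinearMap.toMatrix_apply, hb, Function.comp_def] using h2

end Transport

/-! ### The particle-fluid system along characteristics -/

section Characteristics

variable {d N : ℕ} {P : Model d} {T : ℝ} {xd : Fin N → Vec d} {x v : Fin N → ℝ → Vec d}
  {ρ : ℝ → Vec d → ℝ} {u : ℝ → Vec d → Vec d} {η : Vec d → ℝ → Vec d} {K : ℝ≥0}

lemma exists_isFlow (hT : 0 ≤ T)
    (hu : ContinuousOn (fun q : ℝ × Vec d => u q.1 q.2) (Icc 0 T ×ˢ univ))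
    (hK : VelocityBound T K u) : ∃ η, IsFlow T u η := by
  have h := fun z => exists_integralCurve_of_bounded_lipschitz hT (fun t ht => (hK t ht).2)
    (fun z' => hu.comp (continuousOn_id.prodMk (continuousOn_const (c := z')))
      (fun t ht => mk_mem_prod ht (mem_univ _))) (fun t ht => (hK t ht).1) z
  choose η h0 h1 using h
  exact ⟨η, h0, h1⟩

lemma divergence_smul {f : Vec d → ℝ} {F : Vec d → Vec d} {z : Vec d}
    (hf : DifferentiableAt ℝ f z) (hF : DifferentiableAt ℝ F z) :
    divergence (fun z' => f z' • F z') z = f z * divergence F z + fderiv ℝ f z (F z) := by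
  have h1 : fderiv ℝ f z (F z) = ∑ i, F z i * fderiv ℝ f z (EuclideanSpace.single i 1) := by
    conv_lhs => rw [← (EuclideanSpace.basisFun (Fin d) ℝ).sum_repr (F z)]
    simp
  rw [h1, divergence, divergence, Finset.mul_sum, ← Finset.sum_add_distrib]
  refine Finset.sum_congr rfl fun i _ => ?_
  rw [fderiv_fun_smul hf hF]
  simp [mul_comm]

/-- Along a characteristic, the density times the Jacobian of the flow is constant. -/
lemma IsParticleFluidSolution.density_mul_det (hT : 0 < T)
    (h : IsParticleFluidSolution P T xd x v ρ u) (hη : IsFlow T u η) {z : Vec d}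
    {J : ℝ → Vec d →L[ℝ] Vec d} (hJ0 : J 0 = ContinuousLinearMap.id ℝ (Vec d))
    (hJ : ∀ t ∈ Icc 0 T,
      HasDerivWithinAt J ((fderiv ℝ (u t) (η z t)).comp (J t)) (Icc 0 T) t)
    {t : ℝ} (ht : t ∈ Icc 0 T) : ρ t (η z t) * (J t).det = ρ 0 z := by
  have hder : ∀ s ∈ Icc 0 T,
      HasDerivWithinAt (fun s => ρ s (η z s) * (J s).det) 0 (Icc 0 T) s := by
    intro s hs
    have h1 := hasDerivWithinAt_along_curve hT h.ρ_contDiff hs (hη.deriv z s hs)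
    have h2 := hasDerivWithinAt_det_clm (hJ s hs)
    rw [← divergence_eq_trace] at h2
    have h3 := h.continuity_eq s hs (η z s)
    rw [divergence_smul (hasFDerivAt_space_of_contDiffOn h.ρ_contDiff hs _).differentiableAt
      (hasFDerivAt_space_of_contDiffOn h.u_contDiff hs _).differentiableAt] at h3
    refine (h1.mul h2).congr_deriv ?_
    linear_combination (J s).det * h3
  have hc := constant_of_has_deriv_right_zero (f := fun s => ρ s (η z s) * (J s).det) (a := 0)
    (b := T) (fun s hs => (hder s hs).continuousWithinAt)
    (fun s hs => hasDerivWithinAt_Ici_of_Icc (hder s (Ico_subset_Icc_self hs)) hs) t ht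
  simpa [hη.initial, hJ0, ContinuousLinearMap.det] using hc

/-- The fluid density is transported by the flow of the fluid velocity. -/
lemma IsParticleFluidSolution.map_flow (hT : 0 < T)
    (h : IsParticleFluidSolution P T xd x v ρ u) (hη : IsFlow T u η) (hK : VelocityBound T K u)
    {t : ℝ} (ht : t ∈ Icc 0 T) :
    (densityMeasure (ρ 0)).map (fun z => η z t) = densityMeasure (ρ t) := by
  have hlip : ∀ t ∈ Icc 0 T, LipschitzWith K (u t) := fun t ht => (hK t ht).2
  choose J hJ0 hJ hJd using hη.exists_hasFDerivAt hT hlip h.u_contDiff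
  have hmeas : Measurable fun z => η z t :=
    (continuous_iff_continuousAt.2 fun z => (hJd z t ht).continuousAt).measurable
  have := h.ρ_prob 0 (left_mem_Icc.2 hT.le)
  have := h.ρ_prob t ht
  have : IsProbabilityMeasure ((densityMeasure (ρ 0)).map (fun z => η z t)) :=
    Measure.isProbabilityMeasure_map hmeas.aemeasurable
  -- Both measures have mass one, so one inequality suffices and surjectivity of the flow need not
  -- be known.
  refine Measure.eq_of_le_of_isProbabilityMeasure (Measure.le_iff.2 fun B hB => ?_)
  rw [Measure.map_apply hmeas hB, densityMeasure, densityMeasure,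
    withDensity_apply _ (hmeas hB), withDensity_apply _ hB]
  have hcv := lintegral_image_eq_lintegral_abs_det_fderiv_mul volume (hmeas hB)
    (fun z _ => (hJd z t ht).hasFDerivWithinAt) (hη.injective hlip ht).injOn
    (fun z => ENNReal.ofReal (ρ t z))
  have hle : ∫⁻ z in (fun z => η z t) '' ((fun z => η z t) ⁻¹' B), ENNReal.ofReal (ρ t z)
      ≤ ∫⁻ z in B, ENNReal.ofReal (ρ t z) := lintegral_mono_set (image_preimage_subset _ _)
  refine le_of_eq_of_le ?_ hle
  rw [hcv]
  refine lintegral_congr fun z => ?_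
  rw [← ENNReal.ofReal_mul (abs_nonneg _), ← h.density_mul_det hT hη (hJ0 z) (hJ z) ht]
  -- Positivity of the density at both times forces the Jacobian determinant to be positive, so the
  -- absolute value disappears.
  have hpos : 0 < ρ t (η z t) * (J z t).det := by
    rw [h.density_mul_det hT hη (hJ0 z) (hJ z) ht]
    exact h.ρ_pos 0 (left_mem_Icc.2 hT.le) z
  rw [abs_of_pos (pos_of_mul_pos_right hpos (h.ρ_pos t ht _).le), mul_comm]

/-- The velocity form of the momentum equation. -/
lemma IsParticleFluidSolution.velocity_eq (hT : 0 < T)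
    (h : IsParticleFluidSolution P T xd x v ρ u) {t : ℝ} (ht : t ∈ Icc 0 T) (z : Vec d) :
    derivWithin (fun s => u s z) (Icc 0 T) t + fderiv ℝ (u t) z (u t z)
      = fluidForce P (fun j => x j t) (fun j => v j t) (ρ t) (u t) z := by
  have hud := hasDerivWithinAt_along_curve hT h.u_contDiff ht (hasDerivWithinAt_const t _ z)
  have hρd := hasDerivWithinAt_along_curve hT h.ρ_contDiff ht (hasDerivWithinAt_const t _ z)
  have huf := (hasFDerivAt_space_of_contDiffOn h.u_contDiff ht z).differentiableAt
  have hρf := (hasFDerivAt_space_of_contDiffOn h.ρ_contDiff ht z).differentiableAt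
  simp only [map_zero, add_zero] at hud hρd
  ext k
  let p : Vec d →L[ℝ] ℝ := EuclideanSpace.proj k
  have hukd : HasDerivWithinAt (fun s => u s z k) (derivWithin (fun s => u s z) (Icc 0 T) t k)
      (Icc 0 T) t := p.hasFDerivAt.comp_hasDerivWithinAt t hud
  have hukf : HasFDerivAt (fun z' => u t z' k) (p.comp (fderiv ℝ (u t) z)) z :=
    p.hasFDerivAt.comp z huf.hasFDerivAt
  have h1 := h.momentum_eq t ht z k
  have h2 := h.continuity_eq t ht z
  rw [(hρd.fun_mul hukd).derivWithin (uniqueDiffOn_Icc hT t ht)] at h1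
  -- Grouping the flux as u_k (ρu) makes div(ρu) appear in the product rule, so u_k times the
  -- continuity equation can be subtracted.
  have h3 : (fun z' => (ρ t z' * u t z' k) • u t z') =
      fun z' => u t z' k • (ρ t z' • u t z') := by
    ext1 z'
    rw [smul_smul, mul_comm]
  rw [h3, divergence_smul hukf.differentiableAt (hρf.fun_smul huf), hukf.fderiv] at h1
  have h4 : (p.comp (fderiv ℝ (u t) z)) (ρ t z • u t z)
      = ρ t z * (fderiv ℝ (u t) z (u t z)) k := by simp [p]
  rw [h4] at h1
  refine mul_left_cancel₀ (h.ρ_pos t ht z).ne' ?_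
  rw [PiLp.add_apply]
  linear_combination h1 - u t z k * h2

end Characteristics

/-! ### Integration against empirical measures -/

section Empirical

variable {X : Type*} [MeasurableSpace X] {n : ℕ}

lemma lintegral_empirical [MeasurableSingletonClass X] (z : Fin n → X) (f : X → ℝ≥0∞) :
    ∫⁻ a, f a ∂(empirical z) = (n : ℝ≥0∞)⁻¹ * ∑ i, f (z i) := by
  simp [empirical]

lemma integral_empirical [MeasurableSingletonClass X] {F : Type*} [NormedAddCommGroup F]
    [NormedSpace ℝ F] [CompleteSpace F] (z : Fin n → X) (f : X → F) :
    ∫ a, f a ∂(empirical z) = (n : ℝ)⁻¹ • ∑ i, f (z i) := by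
  rw [empirical, integral_smul_measure, integral_finsetSum_measure]
  · simp
  · intro i _
    exact integrable_dirac (by simp)

lemma integrable_empirical [MeasurableSingletonClass X] {F : Type*} [NormedAddCommGroup F]
    (z : Fin n → X) (f : X → F) (hn : 0 < n) : Integrable f (empirical z) := by
  refine Integrable.smul_measure ?_ (by simp [hn.ne'])
  exact integrable_finsetSum_measure.2 fun i _ => integrable_dirac (by simp)

lemma isProbabilityMeasure_empirical (z : Fin n → X) (hn : 0 < n) :
    IsProbabilityMeasure (empirical z) := by
  constructor
  simp only [empirical, Measure.smul_apply, Measure.finsetSum_apply, measure_univ,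
    Finset.sum_const, Finset.card_univ, Fintype.card_fin, nsmul_eq_mul, mul_one, smul_eq_mul]
  exact ENNReal.inv_mul_cancel (by simp [hn.ne']) (by simp)

lemma map_empirical {Y : Type*} [MeasurableSpace Y] (z : Fin n → X) {g : X → Y}
    (hg : Measurable g) : (empirical z).map g = empirical fun i => g (z i) := by
  ext s hs
  simp [empirical, Measure.map_apply hg hs, Measure.dirac_apply' _ hs,
    Measure.dirac_apply' _ (hg hs)]
  rfl

end Empirical

/-! ### Couplings with an empirical measure -/

section Wasserstein

variable {d M : ℕ}

/-- A coupling with an empirical measure disintegrates over the atoms, with multiplicity. -/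
lemma exists_disintegration_empirical (hM : 0 < M) {y : Fin M → Vec d}
    {γ : Measure (Vec d × Vec d)} (hγ : γ.map Prod.fst = empirical y) :
    ∃ ν : Fin M → Measure (Vec d), (∀ i, IsProbabilityMeasure (ν i)) ∧
      ∀ f : Vec d × Vec d → ℝ≥0∞, Measurable f →
        ∫⁻ p, f p ∂γ = (M : ℝ≥0∞)⁻¹ * ∑ i, ∫⁻ z, f (y i, z) ∂(ν i) := by
  have := isProbabilityMeasure_empirical y hM
  have hγp : IsProbabilityMeasure γ := by
    constructor
    rw [← measure_univ (μ := empirical y), ← hγ, Measure.map_apply measurable_fst .univ,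
      preimage_univ]
  -- Followers at the same point share the conditional law there, which is what counting atoms with
  -- multiplicity requires.
  refine ⟨fun i => γ.condKernel (y i), fun i => inferInstance, fun f hf => ?_⟩
  conv_lhs => rw [← γ.disintegrate γ.condKernel]
  rw [Measure.lintegral_compProd hf, Measure.fst, hγ, lintegral_empirical]

/-- Propagation of the Wasserstein distance to an empirical measure. -/
lemma wasserstein1_empirical_map_le (hM : 0 < M) (y₀ y : Fin M → Vec d) (μ : Measure (Vec d))
    {g : Vec d → Vec d} {Λ : ℝ≥0} (hΛ : 0 < Λ) (hg : LipschitzWith Λ g) :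
    wasserstein1 (empirical y) (μ.map g) ≤
      (M : ℝ≥0∞)⁻¹ * ∑ i, edist (y i) (g (y₀ i)) + Λ * wasserstein1 (empirical y₀) μ := by
  rw [wasserstein1, wasserstein1,
    ENNReal.mul_iInf_of_ne (by exact_mod_cast hΛ.ne') ENNReal.coe_ne_top, ENNReal.add_iInf]
  refine le_iInf fun ⟨γ, hγ1, hγ2⟩ => ?_
  obtain ⟨ν, hν, hdis⟩ := exists_disintegration_empirical hM hγ1
  have hgm : Measurable g := hg.continuous.measurable
  have hpm : ∀ i, Measurable fun z => (y i, g z) := fun i => measurable_const.prodMk hgm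
  -- The fluid mass coupled to y₀ i is moved by g and attached to y i. The coupling is split by
  -- index because followers that start together may separate, so y need not be a function of y₀.
  let γ' : Measure (Vec d × Vec d) :=
    (M : ℝ≥0∞)⁻¹ • ∑ i, (ν i).map fun z => (y i, g z)
  have hint : ∀ f : Vec d × Vec d → ℝ≥0∞, Measurable f →
      ∫⁻ p, f p ∂γ' = (M : ℝ≥0∞)⁻¹ * ∑ i, ∫⁻ z, f (y i, g z) ∂(ν i) := by
    intro f hf
    simp only [γ', lintegral_smul_measure, lintegral_finsetSum_measure, smul_eq_mul]
    congr 1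
    exact Finset.sum_congr rfl fun i _ => lintegral_map hf (hpm i)
  have h1 : γ'.map Prod.fst = empirical y := by
    refine Measure.ext_of_lintegral _ fun f hf => ?_
    rw [lintegral_map hf measurable_fst, hint (fun p => f p.1) (hf.comp measurable_fst),
      lintegral_empirical]
    simp
  have h2 : γ'.map Prod.snd = μ.map g := by
    refine Measure.ext_of_lintegral _ fun f hf => ?_
    rw [lintegral_map hf measurable_snd, hint (fun p => f p.2) (hf.comp measurable_snd),
      lintegral_map hf hgm, ← hγ2, lintegral_map (f := fun z => f (g z)) (hf.comp hgm) measurable_snd,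
      hdis (fun p => f (g p.2)) ((hf.comp hgm).comp measurable_snd)]
  refine (iInf_le _ ⟨γ', h1, h2⟩).trans ?_
  rw [hint _ measurable_edist, hdis _ measurable_edist, mul_left_comm, ← mul_add,
    Finset.mul_sum (a := (Λ : ℝ≥0∞)), ← Finset.sum_add_distrib]
  gcongr with i
  calc ∫⁻ z, edist (y i) (g z) ∂(ν i)
      ≤ ∫⁻ z, (edist (y i) (g (y₀ i)) + Λ * edist (y₀ i) z) ∂(ν i) :=
        lintegral_mono fun z => (edist_triangle _ (g (y₀ i)) _).trans
          (add_le_add le_rfl (hg _ _))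
    _ = edist (y i) (g (y₀ i)) + Λ * ∫⁻ z, edist (y₀ i) z ∂(ν i) := by
        rw [lintegral_add_left measurable_const, lintegral_const, measure_univ, mul_one,
          lintegral_const_mul _ (by fun_prop)]

/-- Lipschitz observables are controlled by the Wasserstein distance. -/
lemma enorm_integral_sub_le_wasserstein1 {F : Type*} [NormedAddCommGroup F] [NormedSpace ℝ F]
    {μ ν : Measure (Vec d)} {f : Vec d → F} {L : ℝ≥0} (hL : 0 < L) (hf : LipschitzWith L f)
    (hμ : Integrable f μ) (hν : Integrable f ν) :
    ‖∫ z, f z ∂μ - ∫ z, f z ∂ν‖ₑ ≤ L * wasserstein1 μ ν := by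
  rw [wasserstein1, ENNReal.mul_iInf_of_ne (by exact_mod_cast hL.ne') ENNReal.coe_ne_top]
  refine le_iInf fun ⟨γ, hγ1, hγ2⟩ => ?_
  subst hγ1 hγ2
  have h1 : Integrable (fun p : Vec d × Vec d => f p.1) γ :=
    (integrable_map_measure hμ.1 measurable_fst.aemeasurable).1 hμ
  have h2 : Integrable (fun p : Vec d × Vec d => f p.2) γ :=
    (integrable_map_measure hν.1 measurable_snd.aemeasurable).1 hν
  rw [integral_map measurable_fst.aemeasurable hμ.1, integral_map measurable_snd.aemeasurable hν.1,
    ← integral_sub h1 h2]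
  refine (enorm_integral_le_lintegral_enorm _).trans ?_
  rw [← lintegral_const_mul _ measurable_edist]
  refine lintegral_mono fun p => ?_
  rw [← edist_eq_enorm_sub]
  exact hf _ _

end Wasserstein

/-! ### Arithmetic means and energy inequalities -/

section Average

variable {n : ℕ}

/-- The arithmetic mean of a finite family of real numbers. -/
def avg (f : Fin n → ℝ) : ℝ := (n : ℝ)⁻¹ * ∑ i, f i

lemma avg_nonneg {f : Fin n → ℝ} (hf : ∀ i, 0 ≤ f i) : 0 ≤ avg f :=
  mul_nonneg (by positivity) (Finset.sum_nonneg fun i _ => hf i)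

lemma avg_mono {f g : Fin n → ℝ} (h : ∀ i, f i ≤ g i) : avg f ≤ avg g := by
  unfold avg
  gcongr with i
  exact h i

lemma avg_add (f g : Fin n → ℝ) : avg (fun i => f i + g i) = avg f + avg g := by
  simp [avg, Finset.sum_add_distrib, mul_add]

lemma avg_const_mul (c : ℝ) (f : Fin n → ℝ) : avg (fun i => c * f i) = c * avg f := by
  simp only [avg, ← Finset.mul_sum]
  ring

lemma avg_const (hn : 0 < n) (c : ℝ) : avg (fun _ : Fin n => c) = c := by
  have : (n : ℝ) ≠ 0 := by positivity
  simp [avg, this]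

lemma avg_mul_sq_le (f g : Fin n → ℝ) :
    avg (fun i => f i * g i) ^ 2 ≤ avg (fun i => f i ^ 2) * avg (fun i => g i ^ 2) := by
  have h := Finset.sum_mul_sq_le_sq_mul_sq Finset.univ f g
  calc avg (fun i => f i * g i) ^ 2 = ((n : ℝ)⁻¹) ^ 2 * (∑ i, f i * g i) ^ 2 := by
        rw [avg, mul_pow]
    _ ≤ ((n : ℝ)⁻¹) ^ 2 * ((∑ i, f i ^ 2) * ∑ i, g i ^ 2) := by gcongr
    _ = _ := by
        rw [avg, avg]
        ring

lemma avg_sq_le (hn : 0 < n) (f : Fin n → ℝ) : avg f ^ 2 ≤ avg fun i => f i ^ 2 := by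
  have h := avg_mul_sq_le f fun _ => 1
  simpa [avg_const hn] using h

lemma norm_smul_sum_le_avg {E : Type*} [NormedAddCommGroup E] [NormedSpace ℝ E] {f : Fin n → E}
    {b : Fin n → ℝ} (h : ∀ i, ‖f i‖ ≤ b i) : ‖(n : ℝ)⁻¹ • ∑ i, f i‖ ≤ avg b := by
  rw [norm_smul, norm_inv, RCLike.norm_natCast]
  exact mul_le_mul_of_nonneg_left ((norm_sum_le _ _).trans (Finset.sum_le_sum fun i _ => h i))
    (by positivity)

variable {E : Type*} [NormedAddCommGroup E] [InnerProductSpace ℝ E]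

lemma hasDerivWithinAt_avg_norm_sq {f : Fin n → ℝ → E} {f' : Fin n → E} {s : Set ℝ} {t : ℝ}
    (hf : ∀ i, HasDerivWithinAt (f i) (f' i) s t) :
    HasDerivWithinAt (fun r => avg fun i => ‖f i r‖ ^ 2)
      (avg fun i => 2 * inner ℝ (f i t) (f' i)) s t :=
  (HasDerivWithinAt.fun_sum fun i _ => (hf i).norm_sq).const_mul _

/-- Young's inequality 2‖f‖r ≤ ‖f‖² + r² applied in each term. Each mean square in the Grönwall
arguments is differentiated and bounded in this form. -/
lemma avg_inner_le {f f' : Fin n → E} {c : ℝ} {r : Fin n → ℝ}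
    (h : ∀ i, ‖f' i‖ ≤ c * ‖f i‖ + r i) :
    (avg fun i => 2 * inner ℝ (f i) (f' i)) ≤
      (2 * c + 1) * (avg fun i => ‖f i‖ ^ 2) + avg fun i => r i ^ 2 := by
  rw [← avg_const_mul, ← avg_add]
  refine avg_mono fun i => ?_
  have h1 := real_inner_le_norm (f i) (f' i)
  have h2 := mul_le_mul_of_nonneg_left (h i) (norm_nonneg (f i))
  nlinarith [sq_nonneg (‖f i‖ - r i)]

end Average

/-! ### Stability of the forces on followers and leaders -/

section Forces

variable {d : ℕ}

/-- Evenness enters the estimates through this oddness, which matches the particle forces ∇W(x_j -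
x_i) with the fluid forces -∇W * μ. -/
lemma gradient_neg_of_even {W : Vec d → ℝ} (hW : ∀ x, W x = W (-x)) (x : Vec d) :
    ∇ W (-x) = -∇ W x := by
  have h : fderiv ℝ W x = -fderiv ℝ W (-x) := by
    conv_lhs => rw [show W = W ∘ ContinuousLinearEquiv.neg ℝ from funext hW]
    rw [ContinuousLinearEquiv.comp_right_fderiv]
    ext z
    simp
  simp [gradient, h]

/-- All bounds and Lipschitz constants of the model are at most `κ`. -/
structure Model.BoundedBy (P : Model d) (κ : ℝ≥0) : Prop where
  one_le : 1 ≤ κ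
  α_nonneg : 0 ≤ P.α
  α_le : P.α ≤ 1
  WL_odd : ∀ x, ∇ P.WL (-x) = -∇ P.WL x
  WF_odd : ∀ x, ∇ P.WF (-x) = -∇ P.WF x
  WC_odd : ∀ x, ∇ P.WC (-x) = -∇ P.WC x
  WL_le : ∀ x, ‖∇ P.WL x‖ ≤ κ
  WF_le : ∀ x, ‖∇ P.WF x‖ ≤ κ
  WL_lip : LipschitzWith κ (∇ P.WL)
  WF_lip : LipschitzWith κ (∇ P.WF)
  WC_lip : LipschitzWith κ (∇ P.WC)
  φ_le : ∀ x, |P.φ x| ≤ κ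
  φ_lip : LipschitzWith κ P.φ

lemma Model.Admissible.exists_boundedBy {P : Model d} (hP : P.Admissible) (K : ℝ≥0) :
    ∃ κ, K ≤ κ ∧ P.BoundedBy κ := by
  obtain ⟨-, k1, hb1, hl1⟩ := hP.WL_regular
  obtain ⟨-, k2, hb2, hl2⟩ := hP.WF_regular
  obtain ⟨-, k3, hb3, hl3⟩ := hP.WC_regular
  obtain ⟨k4, hb4, hl4⟩ := hP.φ_sobolev
  -- The summand 1 makes κ positive: a factor can be pulled into the infimum defining `wasserstein1`
  -- only if it is nonzero.
  refine ⟨K + 1 + k1 + k2 + k3 + k4, ?_, ?_⟩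
  · rw [add_assoc, add_assoc, add_assoc, add_assoc]
    exact le_self_add
  have e1 : k1 ≤ K + 1 + k1 + k2 + k3 + k4 := by
    rw [add_assoc, add_assoc]; exact le_add_self.trans le_self_add
  have e2 : k2 ≤ K + 1 + k1 + k2 + k3 + k4 := by
    rw [add_assoc]; exact le_add_self.trans le_self_add
  have e3 : k3 ≤ K + 1 + k1 + k2 + k3 + k4 := le_add_self.trans le_self_add
  have e4 : k4 ≤ K + 1 + k1 + k2 + k3 + k4 := le_add_self
  exact
    { one_le := by
        rw [add_assoc, add_assoc, add_assoc]; exact le_add_self.trans le_self_add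
      α_nonneg := hP.α_mem.1
      α_le := hP.α_mem.2
      WL_odd := gradient_neg_of_even hP.WL_symm
      WF_odd := gradient_neg_of_even hP.WF_symm
      WC_odd := gradient_neg_of_even hP.WC_symm
      WL_le := fun x => (hb1 x).trans (by exact_mod_cast e1)
      WF_le := fun x => (hb2 x).trans (by exact_mod_cast e2)
      WL_lip := hl1.weaken e1
      WF_lip := hl2.weaken e2
      WC_lip := hl3.weaken e3
      φ_le := fun x => (hb4 x).trans (by exact_mod_cast e4)
      φ_lip := hl4.weaken e4 }

variable {M N : ℕ} {P : Model d} {κ : ℝ≥0} {μ : Measure (Vec d)} {ω : ℝ}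

lemma norm_integral_sub_le_of_wasserstein1_le {F : Type*} [NormedAddCommGroup F]
    [NormedSpace ℝ F] {μ ν : Measure (Vec d)} {f : Vec d → F} {L : ℝ≥0} {ω : ℝ} (hω : 0 ≤ ω)
    (hL : 0 < L) (hf : LipschitzWith L f) (hμ : Integrable f μ) (hν : Integrable f ν)
    (h : wasserstein1 μ ν ≤ ENNReal.ofReal ω) :
    ‖∫ z, f z ∂μ - ∫ z, f z ∂ν‖ ≤ L * ω := by
  have h1 := (enorm_integral_sub_le_wasserstein1 hL hf hμ hν).trans (mul_le_mul_right h L)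
  rw [← ENNReal.ofReal_coe_nnreal, ← ENNReal.ofReal_mul L.coe_nonneg, ← ofReal_norm] at h1
  exact (ENNReal.ofReal_le_ofReal_iff (by positivity)).1 h1

/-- Stability of the force acting on a follower. -/
lemma Model.BoundedBy.followerForce_sub_le (hκ : P.BoundedBy κ) (hM : 0 < M)
    (x v xb vb : Fin N → Vec d) (y w : Fin M → Vec d) {r : Vec d → ℝ} {U : Vec d → Vec d}
    (hU : ∀ z, ‖U z‖ ≤ κ) (hr : IsProbabilityMeasure (densityMeasure r)) (hω : 0 ≤ ω)
    (hW : wasserstein1 (empirical y) (densityMeasure r) ≤ ENNReal.ofReal ω) (hN : 0 < N)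
    (i : Fin M) :
    ‖(M : ℝ)⁻¹ • ∑ j, ∇ P.WF (y j - y i) + (N : ℝ)⁻¹ • ∑ j, ∇ P.WC (x j - y i)
      + (N : ℝ)⁻¹ • ∑ j, P.φ (x j - y i) • (v j - w i) - fluidForce P xb vb r U (y i)‖
      ≤ κ * ‖w i - U (y i)‖ + κ * (ω + (avg fun j => ‖x j - xb j‖) + (avg fun j => ‖v j - vb j‖)
        + avg fun j => ‖x j - xb j‖ * (‖vb j‖ + κ)) := by
  have hκ0 : 0 < κ := lt_of_lt_of_le one_pos hκ.one_le
  have hF : ‖(M : ℝ)⁻¹ • ∑ j, ∇ P.WF (y j - y i) + gradConv P.WF (densityMeasure r) (y i)‖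
      ≤ κ * ω := by
    have hlip : LipschitzWith κ fun z => ∇ P.WF (z - y i) := by
      refine LipschitzWith.of_dist_le_mul fun a b => ?_
      simpa using hκ.WF_lip.dist_le_mul (a - y i) (b - y i)
    have hint : Integrable (fun z => ∇ P.WF (z - y i)) (densityMeasure r) :=
      Integrable.of_bound hlip.continuous.aestronglyMeasurable κ
        (Eventually.of_forall fun z => hκ.WF_le _)
    have h := norm_integral_sub_le_of_wasserstein1_le hω hκ0 hlip (integrable_empirical y _ hM)
      hint hW
    have hodd : gradConv P.WF (densityMeasure r) (y i)
        = -∫ z, ∇ P.WF (z - y i) ∂(densityMeasure r) := by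
      rw [gradConv, ← integral_neg]
      congr 1
      ext1 z
      rw [← hκ.WF_odd, neg_sub]
    rwa [integral_empirical, sub_eq_add_neg, ← hodd] at h
  have hC : ‖(N : ℝ)⁻¹ • ∑ j, ∇ P.WC (x j - y i) + gradConv P.WC (empirical xb) (y i)‖
      ≤ κ * avg fun j => ‖x j - xb j‖ := by
    rw [gradConv, integral_empirical, ← smul_add, ← Finset.sum_add_distrib, ← avg_const_mul]
    refine norm_smul_sum_le_avg fun j => ?_
    rw [← neg_sub (xb j) (y i), hκ.WC_odd, ← sub_eq_add_neg]
    refine (hκ.WC_lip.norm_sub_le _ _).trans_eq ?_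
    rw [sub_sub_sub_cancel_right]
  have hφ : ‖(N : ℝ)⁻¹ • ∑ j, P.φ (x j - y i) • (v j - w i)
      - ∫ p : Vec d × Vec d, P.φ (p.1 - y i) • (p.2 - U (y i)) ∂(empirical fun j => (xb j, vb j))‖
      ≤ κ * ‖w i - U (y i)‖ + κ * (avg fun j => ‖v j - vb j‖)
        + κ * avg fun j => ‖x j - xb j‖ * (‖vb j‖ + κ) := by
    rw [integral_empirical, ← smul_sub, ← Finset.sum_sub_distrib,
      ← avg_const hN (κ * ‖w i - U (y i)‖), ← avg_const_mul, ← avg_const_mul, ← avg_add, ← avg_add]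
    refine norm_smul_sum_le_avg fun j => ?_
    -- The first part sees only velocity errors. In the second the position error multiplies v̄_j,
    -- so it is kept as a mean of products until Cauchy-Schwarz is applied.
    have hsplit : P.φ (x j - y i) • (v j - w i) - P.φ (xb j - y i) • (vb j - U (y i))
        = P.φ (x j - y i) • ((v j - vb j) - (w i - U (y i)))
          + (P.φ (x j - y i) - P.φ (xb j - y i)) • (vb j - U (y i)) := by
      module
    rw [hsplit]
    have h1 : ‖P.φ (x j - y i) • ((v j - vb j) - (w i - U (y i)))‖
        ≤ κ * (‖v j - vb j‖ + ‖w i - U (y i)‖) := by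
      rw [norm_smul]
      exact mul_le_mul (hκ.φ_le _) (norm_sub_le _ _) (norm_nonneg _) κ.coe_nonneg
    have h2 : ‖(P.φ (x j - y i) - P.φ (xb j - y i)) • (vb j - U (y i))‖
        ≤ κ * ‖x j - xb j‖ * (‖vb j‖ + κ) := by
      rw [norm_smul]
      refine mul_le_mul ?_ ((norm_sub_le _ _).trans (by gcongr; exact hU _)) (norm_nonneg _)
        (by positivity)
      refine (hκ.φ_lip.norm_sub_le _ _).trans_eq ?_
      rw [sub_sub_sub_cancel_right]
    linarith [norm_add_le (P.φ (x j - y i) • ((v j - vb j) - (w i - U (y i))))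
      ((P.φ (x j - y i) - P.φ (xb j - y i)) • (vb j - U (y i)))]
  have hsum : (M : ℝ)⁻¹ • ∑ j, ∇ P.WF (y j - y i) + (N : ℝ)⁻¹ • ∑ j, ∇ P.WC (x j - y i)
      + (N : ℝ)⁻¹ • ∑ j, P.φ (x j - y i) • (v j - w i) - fluidForce P xb vb r U (y i)
      = ((M : ℝ)⁻¹ • ∑ j, ∇ P.WF (y j - y i) + gradConv P.WF (densityMeasure r) (y i))
        + ((N : ℝ)⁻¹ • ∑ j, ∇ P.WC (x j - y i) + gradConv P.WC (empirical xb) (y i))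
        + ((N : ℝ)⁻¹ • ∑ j, P.φ (x j - y i) • (v j - w i)
          - ∫ p : Vec d × Vec d, P.φ (p.1 - y i) • (p.2 - U (y i))
            ∂(empirical fun j => (xb j, vb j))) := by
    rw [fluidForce]
    abel
  rw [hsum]
  refine (norm_add₃_le.trans (add_le_add (add_le_add hF hC) hφ)).trans_eq ?_
  ring

/-- Stability of the force acting on a leader. -/
lemma Model.BoundedBy.leaderForce_sub_le (hκ : P.BoundedBy κ) (hM : 0 < M)
    (xd x v xb vb : Fin N → Vec d) (y : Fin M → Vec d) {r : Vec d → ℝ}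
    (hr : Integrable (fun z => z) (densityMeasure r)) (hω : 0 ≤ ω)
    (hW : wasserstein1 (empirical y) (densityMeasure r) ≤ ENNReal.ofReal ω) (hN : 0 < N)
    (i : Fin N) :
    ‖(-(1 - P.α) • (x i - xd i) - P.α • (x i - centerOfMass (empirical y)) - v i
        + (N : ℝ)⁻¹ • ∑ j, ∇ P.WL (x j - x i))
      - (-(1 - P.α) • (xb i - xd i) - P.α • (xb i - centerOfMass (densityMeasure r)) - vb i
        - gradConv P.WL (empirical xb) (xb i))‖
      ≤ 1 * ‖v i - vb i‖
        + ((1 + κ) * ‖x i - xb i‖ + ω + κ * avg fun j => ‖x j - xb j‖) := by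
  have hm : ‖centerOfMass (empirical y) - centerOfMass (densityMeasure r)‖ ≤ ω := by
    have := norm_integral_sub_le_of_wasserstein1_le hω one_pos LipschitzWith.id
      (integrable_empirical y _ hM) hr hW
    simpa [centerOfMass] using this
  have hL : ‖(N : ℝ)⁻¹ • ∑ j, ∇ P.WL (x j - x i) + gradConv P.WL (empirical xb) (xb i)‖
      ≤ κ * ‖x i - xb i‖ + κ * avg fun j => ‖x j - xb j‖ := by
    rw [gradConv, integral_empirical, ← smul_add, ← Finset.sum_add_distrib,
      ← avg_const hN (κ * ‖x i - xb i‖), ← avg_const_mul, ← avg_add]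
    refine norm_smul_sum_le_avg fun j => ?_
    rw [← neg_sub (xb j) (xb i), hκ.WL_odd, ← sub_eq_add_neg, ← mul_add]
    refine (hκ.WL_lip.norm_sub_le _ _).trans ?_
    gcongr
    rw [sub_sub_sub_comm, add_comm]
    exact norm_sub_le _ _
  -- The targets cancel, and since (1 - α) + α = 1 the linear position terms collapse to -(x_i -
  -- x̄_i).
  have hsum : (-(1 - P.α) • (x i - xd i) - P.α • (x i - centerOfMass (empirical y)) - v i
        + (N : ℝ)⁻¹ • ∑ j, ∇ P.WL (x j - x i))
      - (-(1 - P.α) • (xb i - xd i) - P.α • (xb i - centerOfMass (densityMeasure r)) - vb i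
        - gradConv P.WL (empirical xb) (xb i))
      = (P.α • (centerOfMass (empirical y) - centerOfMass (densityMeasure r)) - (v i - vb i))
        + ((N : ℝ)⁻¹ • ∑ j, ∇ P.WL (x j - x i) + gradConv P.WL (empirical xb) (xb i))
        - (x i - xb i) := by
    module
  have hα : ‖P.α • (centerOfMass (empirical y) - centerOfMass (densityMeasure r))‖ ≤ ω := by
    rw [norm_smul, Real.norm_of_nonneg hκ.α_nonneg]
    exact (mul_le_of_le_one_left (norm_nonneg _) hκ.α_le).trans hm
  rw [hsum]
  refine (norm_sub_le _ _).trans ?_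
  have h1 := norm_add_le
    (P.α • (centerOfMass (empirical y) - centerOfMass (densityMeasure r)) - (v i - vb i))
    ((N : ℝ)⁻¹ • ∑ j, ∇ P.WL (x j - x i) + gradConv P.WL (empirical xb) (xb i))
  have h2 := norm_sub_le (P.α • (centerOfMass (empirical y) - centerOfMass (densityMeasure r)))
    (v i - vb i)
  linarith

end Forces

section

variable {d N M : ℕ} {P : Model d} {T : ℝ} {xd : Fin N → Vec d} {x v xb vb : Fin N → ℝ → Vec d}
  {y w : Fin M → ℝ → Vec d} {ρ : ℝ → Vec d → ℝ} {u : ℝ → Vec d → Vec d}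
  {η : Vec d → ℝ → Vec d} {K κ : ℝ≥0}

/-! ### A priori bounds for the particle-fluid system -/

section Moments

lemma DensityBound.mono (h : DensityBound T K ρ) (hK : K ≤ κ) : DensityBound T κ ρ :=
  fun t ht => (h t ht).trans (by exact_mod_cast hK)

lemma VelocityBound.mono (h : VelocityBound T K u) (hK : K ≤ κ) : VelocityBound T κ u :=
  fun t ht => ⟨fun z => ((h t ht).1 z).trans (by exact_mod_cast hK), (h t ht).2.weaken hK⟩

lemma IsParticleFluidSolution.continuous_density (h : IsParticleFluidSolution P T xd xb vb ρ u)
    {t : ℝ} (ht : t ∈ Icc 0 T) : Continuous (ρ t) :=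
  continuous_iff_continuousAt.2 fun z =>
    (hasFDerivAt_space_of_contDiffOn h.ρ_contDiff ht z).continuousAt

lemma IsParticleFluidSolution.lintegral_moment_le (h : IsParticleFluidSolution P T xd xb vb ρ u)
    (hK : DensityBound T K ρ) {t : ℝ} (ht : t ∈ Icc 0 T) :
    ∫⁻ z, ENNReal.ofReal (1 + ‖z‖ ^ 2) ∂(densityMeasure (ρ t)) ≤ K := by
  rw [densityMeasure, lintegral_withDensity_eq_lintegral_mul _
    (h.continuous_density ht).measurable.ennreal_ofReal (by fun_prop)]
  refine le_of_eq_of_le (lintegral_congr fun z => ?_) (hK t ht)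
  rw [Pi.mul_apply, ← ENNReal.ofReal_mul (h.ρ_pos t ht z).le, mul_comm]

lemma IsParticleFluidSolution.lintegral_enorm_le (h : IsParticleFluidSolution P T xd xb vb ρ u)
    (hK : DensityBound T K ρ) {t : ℝ} (ht : t ∈ Icc 0 T) :
    ∫⁻ z, ‖z‖ₑ ∂(densityMeasure (ρ t)) ≤ K := by
  refine (lintegral_mono fun z => ?_).trans (h.lintegral_moment_le hK ht)
  rw [← ofReal_norm]
  exact ENNReal.ofReal_le_ofReal (by nlinarith [sq_nonneg (‖z‖ - 1), norm_nonneg z])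

lemma IsParticleFluidSolution.integrable_id (h : IsParticleFluidSolution P T xd xb vb ρ u)
    (hK : DensityBound T K ρ) {t : ℝ} (ht : t ∈ Icc 0 T) :
    Integrable (fun z => z) (densityMeasure (ρ t)) :=
  ⟨aestronglyMeasurable_id, (h.lintegral_enorm_le hK ht).trans_lt ENNReal.coe_lt_top⟩

lemma IsParticleFluidSolution.norm_centerOfMass_le
    (h : IsParticleFluidSolution P T xd xb vb ρ u) (hK : DensityBound T K ρ) {t : ℝ}
    (ht : t ∈ Icc 0 T) : ‖centerOfMass (densityMeasure (ρ t))‖ ≤ K := by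
  have := (enorm_integral_le_lintegral_enorm fun z : Vec d => z).trans
    (h.lintegral_enorm_le hK ht)
  rw [← ENNReal.ofReal_coe_nnreal, ← ofReal_norm] at this
  exact (ENNReal.ofReal_le_ofReal_iff K.coe_nonneg).1 this

/-- A uniform bound for the velocities of the leaders in the particle-fluid system. -/
lemma IsParticleFluidSolution.avg_leader_velocity_le
    (h : IsParticleFluidSolution P T xd xb vb ρ u) (hN : 0 < N) (hP : P.BoundedBy κ)
    (hK : DensityBound T κ ρ)
    (h0 : (N : ℝ)⁻¹ * ∑ i, (‖xd i‖ ^ 2 + ‖xb i 0‖ ^ 2 + ‖vb i 0‖ ^ 2) ≤ κ)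
    {t : ℝ} (ht : t ∈ Icc 0 T) :
    (avg fun i => ‖vb i t‖ ^ 2) ≤ (κ + 4 * κ ^ 2) * Real.exp (4 * T) := by
  -- Adding this constant to the energy absorbs the source terms: the derivative is at most 4X + 4V
  -- + 3 avg ‖xd‖² + 12κ², with X, V the mean squares of x̄_i and v̄_i. This gives a homogeneous
  -- inequality with rate 4.
  set c : ℝ := (avg fun i => ‖xd i‖ ^ 2) + 4 * κ ^ 2 with hc
  have hc0 : 0 ≤ avg fun i => ‖xd i‖ ^ 2 := avg_nonneg fun i => by positivity
  have hder : ∀ s ∈ Icc 0 T, HasDerivWithinAt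
      (fun s => (avg fun i => ‖xb i s‖ ^ 2) + (avg fun i => ‖vb i s‖ ^ 2) + c) _ (Icc 0 T) s :=
    fun s hs => ((hasDerivWithinAt_avg_norm_sq (h.x_deriv s hs)).add
      (hasDerivWithinAt_avg_norm_sq (h.v_deriv s hs))).add_const c
  have hg := le_mul_exp_of_hasDerivWithinAt (C := 4) hder (fun s hs => by
    have hX := avg_inner_le (f := fun i => xb i s) (f' := fun i => vb i s) (c := 0)
      (r := fun i => ‖vb i s‖) (fun i => by simp)
    have hm := h.norm_centerOfMass_le hK hs
    have hV := avg_inner_le (f := fun i => vb i s)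
      (f' := fun i => -(1 - P.α) • (xb i s - xd i)
        - P.α • (xb i s - centerOfMass (densityMeasure (ρ s))) - vb i s
        - gradConv P.WL (empirical fun j => xb j s) (xb i s)) (c := 1)
      (r := fun i => ‖xb i s‖ + ‖xd i‖ + 2 * κ) (fun i => by
        have hL : ‖gradConv P.WL (empirical fun j => xb j s) (xb i s)‖ ≤ κ := by
          rw [gradConv, integral_empirical, ← avg_const hN (κ : ℝ)]
          exact norm_smul_sum_le_avg fun j => hP.WL_le _
        have hsum : -(1 - P.α) • (xb i s - xd i)
            - P.α • (xb i s - centerOfMass (densityMeasure (ρ s))) - vb i s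
            - gradConv P.WL (empirical fun j => xb j s) (xb i s)
            = ((1 - P.α) • xd i - xb i s)
              + (P.α • centerOfMass (densityMeasure (ρ s)) - vb i s)
              - gradConv P.WL (empirical fun j => xb j s) (xb i s) := by module
        rw [hsum]
        have e1 : ‖(1 - P.α) • xd i‖ ≤ ‖xd i‖ := by
          rw [norm_smul, Real.norm_of_nonneg (by linarith [hP.α_le])]
          exact mul_le_of_le_one_left (norm_nonneg _) (by linarith [hP.α_nonneg])
        have e2 : ‖P.α • centerOfMass (densityMeasure (ρ s))‖ ≤ κ := by
          rw [norm_smul, Real.norm_of_nonneg hP.α_nonneg]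
          exact (mul_le_of_le_one_left (norm_nonneg _) hP.α_le).trans hm
        have e3 := norm_sub_le ((1 - P.α) • xd i) (xb i s)
        have e4 := norm_sub_le (P.α • centerOfMass (densityMeasure (ρ s))) (vb i s)
        have e5 := norm_add_le ((1 - P.α) • xd i - xb i s)
          (P.α • centerOfMass (densityMeasure (ρ s)) - vb i s)
        have e6 := norm_sub_le (((1 - P.α) • xd i - xb i s)
          + (P.α • centerOfMass (densityMeasure (ρ s)) - vb i s))
          (gradConv P.WL (empirical fun j => xb j s) (xb i s))
        linarith)
    have hr : (avg fun i => (‖xb i s‖ + ‖xd i‖ + 2 * κ) ^ 2)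
        ≤ 3 * (avg fun i => ‖xb i s‖ ^ 2) + 3 * (avg fun i => ‖xd i‖ ^ 2) + 12 * κ ^ 2 := by
      rw [← avg_const_mul, ← avg_const_mul, ← avg_const hN (12 * (κ : ℝ) ^ 2), ← avg_add,
        ← avg_add]
      refine avg_mono fun i => ?_
      nlinarith [sq_nonneg (‖xb i s‖ - ‖xd i‖), sq_nonneg (‖xb i s‖ - 2 * κ),
        sq_nonneg (‖xd i‖ - 2 * κ)]
    simp only [hc]
    nlinarith [sq_nonneg (κ : ℝ)]) ht
  have hV0 : 0 ≤ avg fun i => ‖xb i t‖ ^ 2 := avg_nonneg fun i => by positivity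
  have hinit : (avg fun i => ‖xb i 0‖ ^ 2) + (avg fun i => ‖vb i 0‖ ^ 2) + c ≤ κ + 4 * κ ^ 2 := by
    have : (avg fun i => ‖xd i‖ ^ 2 + ‖xb i 0‖ ^ 2 + ‖vb i 0‖ ^ 2) ≤ κ := h0
    rw [avg_add, avg_add] at this
    linarith
  have hexp : Real.exp (4 * t) ≤ Real.exp (4 * T) := by
    gcongr
    exact ht.2
  have := hg.trans (mul_le_mul hinit hexp (Real.exp_pos _).le (by positivity))
  have : 0 ≤ c := by positivity
  linarith

end Moments

end

section

variable {d N M : ℕ} {P : Model d} {T : ℝ} {xd : Fin N → Vec d} {x v xb vb : Fin N → ℝ → Vec d}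
  {y w : Fin M → ℝ → Vec d} {ρ : ℝ → Vec d → ℝ} {u : ℝ → Vec d → Vec d}
  {η : Vec d → ℝ → Vec d} {K κ : ℝ≥0}

/-! ### The discrepancy in real-valued terms -/

section Discrepancy

lemma inv_mul_sum_ofReal {n : ℕ} (hn : 0 < n) {f : Fin n → ℝ} (hf : ∀ i, 0 ≤ f i) :
    (n : ℝ≥0∞)⁻¹ * ∑ i, ENNReal.ofReal (f i) = ENNReal.ofReal (avg f) := by
  rw [avg, ENNReal.ofReal_mul (by positivity), ENNReal.ofReal_inv_of_pos (by positivity),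
    ENNReal.ofReal_natCast, ENNReal.ofReal_sum_of_nonneg fun i _ => hf i]

lemma enorm_sq_eq_ofReal {E : Type*} [SeminormedAddCommGroup E] (a : E) :
    ‖a‖ₑ ^ 2 = ENNReal.ofReal (‖a‖ ^ 2) := by
  rw [← ofReal_norm, ENNReal.ofReal_pow (norm_nonneg _)]

lemma map_fst_followerMeasure (y w : Fin M → ℝ → Vec d) (t : ℝ) :
    (followerMeasure y w t).map Prod.fst = empirical fun i => y i t :=
  map_empirical _ measurable_fst

lemma lintegral_followerMeasure_enorm_sq (hM : 0 < M) (y w : Fin M → ℝ → Vec d) (t : ℝ)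
    (U : Vec d → Vec d) :
    ∫⁻ p, ‖p.2 - U p.1‖ₑ ^ 2 ∂(followerMeasure y w t)
      = ENNReal.ofReal (avg fun i => ‖w i t - U (y i t)‖ ^ 2) := by
  rw [followerMeasure, lintegral_empirical]
  simp only [enorm_sq_eq_ofReal]
  exact inv_mul_sum_ofReal hM fun i => by positivity

lemma leaderDiscrepancy_eq (hN : 0 < N) (x v xb vb : Fin N → ℝ → Vec d) (t : ℝ) :
    leaderDiscrepancy x v xb vb t = ENNReal.ofReal
      ((avg fun i => ‖x i t - xb i t‖ ^ 2) + avg fun i => ‖v i t - vb i t‖ ^ 2) := by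
  rw [leaderDiscrepancy, lintegral_empirical, ← avg_add, ← inv_mul_sum_ofReal hN fun i => by
    positivity]
  simp only [enorm_sq_eq_ofReal]
  congr 1
  exact Finset.sum_congr rfl fun i _ =>
    (ENNReal.ofReal_add (by positivity) (by positivity)).symm

/-- Everything except the Wasserstein distance is a finite sum and passes to real numbers; that
distance may be infinite a priori. -/
lemma discrepancy_eq (hN : 0 < N) (hM : 0 < M) (t : ℝ) :
    discrepancy x v y w xb vb ρ u t =
      wasserstein1 (empirical fun i => y i t) (densityMeasure (ρ t)) ^ 2
        + ENNReal.ofReal ((avg fun i => ‖w i t - u t (y i t)‖ ^ 2)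
          + ((avg fun i => ‖x i t - xb i t‖ ^ 2) + avg fun i => ‖v i t - vb i t‖ ^ 2)) := by
  rw [discrepancy, map_fst_followerMeasure, lintegral_followerMeasure_enorm_sq hM,
    leaderDiscrepancy_eq hN, add_assoc, ← ENNReal.ofReal_add]
  · exact avg_nonneg fun i => by positivity
  · exact add_nonneg (avg_nonneg fun i => by positivity) (avg_nonneg fun i => by positivity)

end Discrepancy

/-! ### The Grönwall estimate for the discrepancy -/

section Stability

/-- Growth of the Wasserstein distance between followers and fluid, in terms of the distance of
the followers to the characteristics that start at the same points. -/
lemma IsParticleFluidSolution.wasserstein1_le (hT : 0 < T) (hM : 0 < M)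
    (h : IsParticleFluidSolution P T xd xb vb ρ u) (hη : IsFlow T u η) (hu : VelocityBound T κ u)
    {a : ℝ} (ha : 0 ≤ a)
    (hW : wasserstein1 (empirical fun i => y i 0) (densityMeasure (ρ 0)) = ENNReal.ofReal a)
    {t : ℝ} (ht : t ∈ Icc 0 T) :
    wasserstein1 (empirical fun i => y i t) (densityMeasure (ρ t)) ≤
      ENNReal.ofReal ((avg fun i => ‖y i t - η (y i 0) t‖) + Real.exp (κ * T) * a) := by
  let Λ : ℝ≥0 := ⟨Real.exp (κ * T), (Real.exp_pos _).le⟩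
  have hlip : LipschitzWith Λ fun z => η z t := by
    refine LipschitzWith.of_dist_le_mul fun z z' => ?_
    rw [dist_eq_norm, dist_eq_norm, mul_comm]
    refine (hη.norm_sub_le (fun s hs => (hu s hs).2) z z' ht).trans ?_
    change _ ≤ ‖z - z'‖ * Real.exp (κ * T)
    gcongr
    exact ht.2
  have key := wasserstein1_empirical_map_le hM (fun i => y i 0) (fun i => y i t)
    (densityMeasure (ρ 0)) (Λ := Λ) (Real.exp_pos _) hlip
  rw [h.map_flow hT hη hu ht, hW] at key
  refine key.trans_eq ?_
  have h1 : (M : ℝ≥0∞)⁻¹ * ∑ i, edist (y i t) (η (y i 0) t)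
      = ENNReal.ofReal (avg fun i => ‖y i t - η (y i 0) t‖) := by
    rw [← inv_mul_sum_ofReal hM fun i => norm_nonneg _]
    simp [edist_eq_enorm_sub]
  have h2 : (Λ : ℝ≥0∞) = ENNReal.ofReal (Real.exp (κ * T)) :=
    (ENNReal.ofReal_coe_nnreal (p := Λ)).symm
  rw [h1, h2, ← ENNReal.ofReal_mul (Real.exp_pos _).le, ← ENNReal.ofReal_add
    (avg_nonneg fun i => norm_nonneg _) (by positivity)]

/-- The velocity error of a follower: its derivative. -/
lemma IsParticleFluidSolution.hasDerivWithinAt_velocity_error (hT : 0 < T)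
    (h : IsParticleFluidSolution P T xd xb vb ρ u) {Y W : ℝ → Vec d} {F : Vec d} {t : ℝ}
    (ht : t ∈ Icc 0 T) (hY : HasDerivWithinAt Y (W t) (Icc 0 T) t)
    (hW : HasDerivWithinAt W F (Icc 0 T) t) :
    HasDerivWithinAt (fun s => W s - u s (Y s))
      ((F - fluidForce P (fun j => xb j t) (fun j => vb j t) (ρ t) (u t) (Y t))
        - fderiv ℝ (u t) (Y t) (W t - u t (Y t))) (Icc 0 T) t := by
  -- The chain rule produces ∂ₜu + Du w. Writing w = u + (w - u) isolates ∂ₜu + Du u, which is the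
  -- fluid force.
  refine (hW.sub (hasDerivWithinAt_along_curve hT h.u_contDiff ht hY)).congr_deriv ?_
  rw [← h.velocity_eq hT ht, map_sub]
  abel

/-- The growth rate in the stability estimate. -/
def growthRate (κ S Λ : ℝ) : ℝ :=
  (2 * κ + 1 + 2 * (4 * κ ^ 2 + 3)) + (1 + (4 * κ + 1))
    + (4 * κ ^ 2 * (1 + 2 * (S + κ ^ 2)) + 1 + 3 * ((1 + κ) ^ 2 + κ ^ 2))
    + (4 * κ ^ 2 + 4) + 2 * Λ ^ 2 * (4 * κ ^ 2 + 3)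

/-- The coefficients are those produced in `IsParticleSolution.stability`, where A = a². All
quantities are nonnegative, so the sum of the coefficients serves as a common rate. -/
lemma sum_le_growthRate_mul {κ S Λ B E X V A : ℝ} (hκ : 0 ≤ κ) (hS : 0 ≤ S) (hB : 0 ≤ B)
    (hE : 0 ≤ E) (hX : 0 ≤ X) (hV : 0 ≤ V) (hA : 0 ≤ A) :
    (2 * κ + 1 + 2 * (4 * κ ^ 2 + 3)) * B + (1 + (4 * κ + 1)) * E
      + (4 * κ ^ 2 * (1 + 2 * (S + κ ^ 2)) + 1 + 3 * ((1 + κ) ^ 2 + κ ^ 2)) * X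
      + (4 * κ ^ 2 + 4) * V + 2 * Λ ^ 2 * (4 * κ ^ 2 + 3) * A
      ≤ growthRate κ S Λ * (B + E + X + V + A) := by
  have key : ∀ {p q r s o : ℝ}, 0 ≤ p → 0 ≤ q → 0 ≤ r → 0 ≤ s → 0 ≤ o →
      p * B + q * E + r * X + s * V + o * A ≤ (p + q + r + s + o) * (B + E + X + V + A) := by
    intro p q r s o hp hq hr hs ho
    have h1 : p * B ≤ p * (B + E + X + V + A) := mul_le_mul_of_nonneg_left (by linarith) hp
    have h2 : q * E ≤ q * (B + E + X + V + A) := mul_le_mul_of_nonneg_left (by linarith) hq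
    have h3 : r * X ≤ r * (B + E + X + V + A) := mul_le_mul_of_nonneg_left (by linarith) hr
    have h4 : s * V ≤ s * (B + E + X + V + A) := mul_le_mul_of_nonneg_left (by linarith) hs
    have h5 : o * A ≤ o * (B + E + X + V + A) := mul_le_mul_of_nonneg_left (by linarith) ho
    linarith
  exact key (by positivity) (by positivity) (by positivity) (by positivity) (by positivity)

lemma three_mul_sq_add_le (a b c : ℝ) :
    (a + b + c) ^ 2 ≤ 3 * (a ^ 2 + b ^ 2 + c ^ 2) := by
  nlinarith [sq_nonneg (a - b), sq_nonneg (a - c), sq_nonneg (b - c)]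

lemma four_mul_sq_add_le (a b c e : ℝ) :
    (a + b + c + e) ^ 2 ≤ 4 * (a ^ 2 + b ^ 2 + c ^ 2 + e ^ 2) := by
  nlinarith [sq_nonneg (a - b), sq_nonneg (a - c), sq_nonneg (b - c), sq_nonneg (a - e),
    sq_nonneg (b - e), sq_nonneg (c - e)]

/-- The Grönwall estimate for the squared distances along trajectories. -/
lemma IsParticleSolution.stability (hT : 0 < T) (hN : 0 < N) (hM : 0 < M) (hP : P.BoundedBy κ)
    (hp : IsParticleSolution P T xd x v y w) (h : IsParticleFluidSolution P T xd xb vb ρ u)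
    (hη : IsFlow T u η) (hρ : DensityBound T κ ρ) (hu : VelocityBound T κ u) {S : ℝ}
    (hS0 : 0 ≤ S) (hS : ∀ t ∈ Icc 0 T, (avg fun i => ‖vb i t‖ ^ 2) ≤ S) {a : ℝ} (ha : 0 ≤ a)
    (hW : wasserstein1 (empirical fun i => y i 0) (densityMeasure (ρ 0)) = ENNReal.ofReal a)
    {t : ℝ} (ht : t ∈ Icc 0 T) :
    (avg fun i => ‖y i t - η (y i 0) t‖ ^ 2) + (avg fun i => ‖w i t - u t (y i t)‖ ^ 2)
      + (avg fun i => ‖x i t - xb i t‖ ^ 2) + (avg fun i => ‖v i t - vb i t‖ ^ 2) + a ^ 2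
      ≤ ((avg fun i => ‖w i 0 - u 0 (y i 0)‖ ^ 2) + (avg fun i => ‖x i 0 - xb i 0‖ ^ 2)
        + (avg fun i => ‖v i 0 - vb i 0‖ ^ 2) + a ^ 2)
        * Real.exp (growthRate κ S (Real.exp (κ * T)) * t) := by
  set Λ := Real.exp (κ * T) with hΛ
  -- The constant a² is part of the energy so that the initial transport error becomes a multiple of
  -- the energy and the inequality stays homogeneous.
  have hder : ∀ s ∈ Icc 0 T, HasDerivWithinAt
      (fun s => (avg fun i => ‖y i s - η (y i 0) s‖ ^ 2) + (avg fun i => ‖w i s - u s (y i s)‖ ^ 2)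
        + (avg fun i => ‖x i s - xb i s‖ ^ 2) + (avg fun i => ‖v i s - vb i s‖ ^ 2) + a ^ 2)
      _ (Icc 0 T) s := fun s hs =>
    ((((hasDerivWithinAt_avg_norm_sq
        fun i => (hp.y_deriv s hs i).sub (hη.deriv (y i 0) s hs)).add
      (hasDerivWithinAt_avg_norm_sq fun i =>
        h.hasDerivWithinAt_velocity_error hT hs (hp.y_deriv s hs i) (hp.w_deriv s hs i))).add
      (hasDerivWithinAt_avg_norm_sq
        fun i => (hp.x_deriv s hs i).sub (h.x_deriv s hs i))).add
      (hasDerivWithinAt_avg_norm_sq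
        fun i => (hp.v_deriv s hs i).sub (h.v_deriv s hs i))).add_const (a ^ 2)
  have hg := le_mul_exp_of_hasDerivWithinAt (C := growthRate κ S Λ) hder (fun s hs => by
    -- A bound for d₁(ϱ_F(s), ρ(s)), through which the nonlocal terms of both forces are estimated.
    set ω : ℝ := (avg fun i => ‖y i s - η (y i 0) s‖) + Λ * a with hω
    have hω0 : 0 ≤ ω := add_nonneg (avg_nonneg fun i => norm_nonneg _) (by positivity)
    have hWs := h.wasserstein1_le hT hM hη hu ha hW hs
    have hB := avg_inner_le (f := fun i => y i s - η (y i 0) s)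
      (f' := fun i => w i s - u s (η (y i 0) s)) (c := κ)
      (r := fun i => ‖w i s - u s (y i s)‖) (fun i => by
        have h1 := (hu s hs).2.norm_sub_le (y i s) (η (y i 0) s)
        have h2 := norm_add_le (u s (y i s) - u s (η (y i 0) s)) (w i s - u s (y i s))
        rw [add_comm (u s (y i s) - u s (η (y i 0) s)), sub_add_sub_cancel] at h2
        linarith)
    have hX := avg_inner_le (f := fun i => x i s - xb i s) (f' := fun i => v i s - vb i s)
      (c := 0) (r := fun i => ‖v i s - vb i s‖) (fun i => by simp)
    have hV := avg_inner_le (f := fun i => v i s - vb i s) (c := 1)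
      (fun i => hP.leaderForce_sub_le hM xd (fun i => x i s) (fun i => v i s) (fun i => xb i s)
        (fun i => vb i s) (fun i => y i s) (h.integrable_id hρ hs) hω0 hWs hN i)
    -- One κ in c = 2κ comes from the drag φ, the other from the Lipschitz constant of u.
    have hE := avg_inner_le (f := fun i => w i s - u s (y i s)) (c := 2 * κ)
      (f' := fun i => ((M : ℝ)⁻¹ • ∑ j, ∇ P.WF (y j s - y i s)
        + (N : ℝ)⁻¹ • ∑ j, ∇ P.WC (x j s - y i s)
        + (N : ℝ)⁻¹ • ∑ j, P.φ (x j s - y i s) • (v j s - w i s)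
        - fluidForce P (fun j => xb j s) (fun j => vb j s) (ρ s) (u s) (y i s))
        - fderiv ℝ (u s) (y i s) (w i s - u s (y i s)))
      (r := fun i => κ * (ω + (avg fun j => ‖x j s - xb j s‖) + (avg fun j => ‖v j s - vb j s‖)
        + avg fun j => ‖x j s - xb j s‖ * (‖vb j s‖ + κ))) (fun i => by
        have h1 := hP.followerForce_sub_le hM (fun i => x i s) (fun i => v i s) (fun i => xb i s)
          (fun i => vb i s) (fun i => y i s) (fun i => w i s) (hu s hs).1 (h.ρ_prob s hs) hω0
          hWs hN i
        have h2 : ‖fderiv ℝ (u s) (y i s) (w i s - u s (y i s))‖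
            ≤ κ * ‖w i s - u s (y i s)‖ :=
          (ContinuousLinearMap.le_opNorm _ _).trans (mul_le_mul_of_nonneg_right
            (norm_fderiv_le_of_lipschitz ℝ (hu s hs).2) (norm_nonneg _))
        refine (norm_sub_le _ _).trans ?_
        linarith)
    have hωsq : ω ^ 2 ≤ 2 * (avg fun i => ‖y i s - η (y i 0) s‖ ^ 2) + 2 * Λ ^ 2 * a ^ 2 := by
      have := avg_sq_le hM fun i => ‖y i s - η (y i 0) s‖
      nlinarith [sq_nonneg ((avg fun i => ‖y i s - η (y i 0) s‖) - Λ * a)]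
    have hXsq := avg_sq_le hN fun i => ‖x i s - xb i s‖
    have hVsq := avg_sq_le hN fun i => ‖v i s - vb i s‖
    have hX0 : 0 ≤ avg fun i => ‖x i s - xb i s‖ ^ 2 := avg_nonneg fun i => by positivity
    have hXVsq : (avg fun j => ‖x j s - xb j s‖ * (‖vb j s‖ + κ)) ^ 2
        ≤ (avg fun i => ‖x i s - xb i s‖ ^ 2) * (2 * (S + κ ^ 2)) := by
      refine (avg_mul_sq_le _ _).trans (mul_le_mul_of_nonneg_left ?_ hX0)
      calc (avg fun j => (‖vb j s‖ + κ) ^ 2) ≤ avg fun j => 2 * ‖vb j s‖ ^ 2 + 2 * κ ^ 2 :=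
            avg_mono fun j => by nlinarith [sq_nonneg (‖vb j s‖ - κ)]
        _ = 2 * (avg fun j => ‖vb j s‖ ^ 2) + 2 * κ ^ 2 := by
            rw [avg_add, avg_const hN, avg_const_mul]
        _ ≤ 2 * (S + κ ^ 2) := by linarith [hS s hs]
    rw [avg_const hM] at hE
    have hRsq : (κ * (ω + (avg fun j => ‖x j s - xb j s‖) + (avg fun j => ‖v j s - vb j s‖)
        + avg fun j => ‖x j s - xb j s‖ * (‖vb j s‖ + κ))) ^ 2
        ≤ 4 * κ ^ 2 * (ω ^ 2 + (avg fun i => ‖x i s - xb i s‖ ^ 2)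
          + (avg fun i => ‖v i s - vb i s‖ ^ 2)
          + (avg fun i => ‖x i s - xb i s‖ ^ 2) * (2 * (S + κ ^ 2))) := by
      rw [mul_pow, mul_comm (4 : ℝ), mul_assoc]
      refine mul_le_mul_of_nonneg_left ?_ (by positivity)
      refine (four_mul_sq_add_le _ _ _ _).trans ?_
      linarith
    have hrsq : (avg fun i => ((1 + κ) * ‖x i s - xb i s‖ + ω
        + κ * avg fun j => ‖x j s - xb j s‖) ^ 2)
        ≤ 3 * ((1 + κ) ^ 2 + κ ^ 2) * (avg fun i => ‖x i s - xb i s‖ ^ 2) + 3 * ω ^ 2 := by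
      calc (avg fun i => ((1 + κ) * ‖x i s - xb i s‖ + ω
              + κ * avg fun j => ‖x j s - xb j s‖) ^ 2)
          ≤ avg fun i => 3 * (1 + κ) ^ 2 * ‖x i s - xb i s‖ ^ 2
              + (3 * ω ^ 2 + 3 * κ ^ 2 * (avg fun j => ‖x j s - xb j s‖) ^ 2) :=
            avg_mono fun i => (three_mul_sq_add_le _ _ _).trans_eq (by ring)
        _ = 3 * (1 + κ) ^ 2 * (avg fun i => ‖x i s - xb i s‖ ^ 2)
              + (3 * ω ^ 2 + 3 * κ ^ 2 * (avg fun j => ‖x j s - xb j s‖) ^ 2) := by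
            rw [avg_add, avg_const hN, avg_const_mul]
        _ ≤ _ := by
            have := mul_le_mul_of_nonneg_left hXsq (by positivity : 0 ≤ 3 * (κ : ℝ) ^ 2)
            linarith
    have hωκ := mul_le_mul_of_nonneg_left hωsq (by positivity : 0 ≤ 4 * (κ : ℝ) ^ 2 + 3)
    refine le_trans ?_ (sum_le_growthRate_mul κ.coe_nonneg hS0 (avg_nonneg fun i => by positivity)
      (avg_nonneg fun i => by positivity) hX0 (avg_nonneg fun i => by positivity) (sq_nonneg a))
    have hsum := add_le_add (add_le_add (add_le_add hB hE) hX) hV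
    refine hsum.trans ?_
    linarith) ht
  simpa [hη.initial, avg] using hg

/-- The stability estimate with an explicit constant. -/
lemma IsParticleSolution.discrepancy_le (hT : 0 < T) (hN : 0 < N) (hM : 0 < M)
    (hP : P.BoundedBy κ) (hp : IsParticleSolution P T xd x v y w)
    (h : IsParticleFluidSolution P T xd xb vb ρ u) (hρ : DensityBound T κ ρ)
    (hu : VelocityBound T κ u) {S : ℝ} (hS0 : 0 ≤ S)
    (hS : ∀ t ∈ Icc 0 T, (avg fun i => ‖vb i t‖ ^ 2) ≤ S) {t : ℝ} (ht : t ∈ Icc 0 T) :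
    discrepancy x v y w xb vb ρ u t ≤ ENNReal.ofReal ((2 + 2 * Real.exp (κ * T) ^ 2)
      * Real.exp (growthRate κ S (Real.exp (κ * T)) * T)) * discrepancy x v y w xb vb ρ u 0 := by
  set Λ := Real.exp (κ * T) with hΛ
  set C := (2 + 2 * Λ ^ 2) * Real.exp (growthRate κ S Λ * T) with hC
  have hCpos : 0 < C := by positivity
  rw [discrepancy_eq hN hM, discrepancy_eq hN hM]
  -- An infinite initial distance makes the right-hand side infinite, because the constant is
  -- positive.
  by_cases hfin : wasserstein1 (empirical fun i => y i 0) (densityMeasure (ρ 0)) = ⊤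
  · rw [hfin]
    simp [ENNReal.mul_top, hCpos]
  set a := (wasserstein1 (empirical fun i => y i 0) (densityMeasure (ρ 0))).toReal with ha'
  have ha : 0 ≤ a := ENNReal.toReal_nonneg
  have hW : wasserstein1 (empirical fun i => y i 0) (densityMeasure (ρ 0)) = ENNReal.ofReal a :=
    (ENNReal.ofReal_toReal hfin).symm
  obtain ⟨η, hη⟩ := exists_isFlow hT.le h.u_contDiff.continuousOn hu
  have hst := hp.stability hT hN hM hP h hη hρ hu hS0 hS ha hW ht
  have hWt := h.wasserstein1_le hT hM hη hu ha hW ht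
  have hnn : ∀ {n : ℕ} (f : Fin n → Vec d), 0 ≤ avg fun i => ‖f i‖ ^ 2 :=
    fun f => avg_nonneg fun i => by positivity
  have hE0 := hnn fun i => w i 0 - u 0 (y i 0)
  have hX0 := hnn fun i => x i 0 - xb i 0
  have hV0 := hnn fun i => v i 0 - vb i 0
  have hE := hnn fun i => w i t - u t (y i t)
  have hX := hnn fun i => x i t - xb i t
  have hV := hnn fun i => v i t - vb i t
  have hB := hnn fun i => y i t - η (y i 0) t
  have hω0 : 0 ≤ (avg fun i => ‖y i t - η (y i 0) t‖) + Λ * a :=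
    add_nonneg (avg_nonneg fun i => norm_nonneg _) (by positivity)
  have hωsq : ((avg fun i => ‖y i t - η (y i 0) t‖) + Λ * a) ^ 2
      ≤ 2 * (avg fun i => ‖y i t - η (y i 0) t‖ ^ 2) + 2 * Λ ^ 2 * a ^ 2 := by
    have := avg_sq_le hM fun i => ‖y i t - η (y i 0) t‖
    nlinarith [sq_nonneg ((avg fun i => ‖y i t - η (y i 0) t‖) - Λ * a)]
  have hexp : Real.exp (growthRate κ S Λ * t) ≤ Real.exp (growthRate κ S Λ * T) := by
    have : 0 ≤ growthRate κ S Λ := by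
      unfold growthRate
      positivity
    gcongr
    exact ht.2
  rw [hW, ← ENNReal.ofReal_pow ha, ← ENNReal.ofReal_add (by positivity) (by positivity),
    ← ENNReal.ofReal_mul hCpos.le]
  refine (add_le_add (pow_le_pow_left₀ zero_le hWt 2) le_rfl).trans ?_
  rw [← ENNReal.ofReal_pow hω0, ← ENNReal.ofReal_add (by positivity) (by positivity)]
  refine ENNReal.ofReal_le_ofReal ?_
  have hst' := hst.trans (mul_le_mul_of_nonneg_left hexp (by positivity))
  -- The factor 2 + 2Λ² covers ω² ≤ 2B + 2Λ²a² together with E + X + V.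
  have hst2 := mul_le_mul_of_nonneg_left hst' (by positivity : 0 ≤ 2 + 2 * Λ ^ 2)
  have hΛ2 : 0 ≤ Λ ^ 2 := sq_nonneg _
  have := mul_nonneg hΛ2 hE
  have := mul_nonneg hΛ2 hX
  have := mul_nonneg hΛ2 hV
  have := mul_nonneg hΛ2 hB
  have := sq_nonneg a
  rw [hC]
  linarith

/-- The quantitative stability estimate. -/
theorem Model.Admissible.exists_discrepancy_le (hT : 0 < T) (hP : P.Admissible) (K : ℝ≥0) :
    ∃ C : ℝ≥0, 0 < C ∧
      ∀ (N : ℕ), 0 < N → ∀ (xd : Fin N → Vec d) (xb vb : Fin N → ℝ → Vec d)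
        (ρ : ℝ → Vec d → ℝ) (u : ℝ → Vec d → Vec d),
        IsParticleFluidSolution P T xd xb vb ρ u →
        DensityBound T K ρ → VelocityBound T K u →
        (N : ℝ)⁻¹ * ∑ i, (‖xd i‖ ^ 2 + ‖xb i 0‖ ^ 2 + ‖vb i 0‖ ^ 2) ≤ K →
        ∀ (M : ℕ), 0 < M → ∀ (x v : Fin N → ℝ → Vec d) (y w : Fin M → ℝ → Vec d),
          IsParticleSolution P T xd x v y w →
          ∀ t ∈ Icc 0 T,
            discrepancy x v y w xb vb ρ u t ≤ C * discrepancy x v y w xb vb ρ u 0 := by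
  obtain ⟨κ, hKκ, hκ⟩ := hP.exists_boundedBy K
  let S : ℝ := (κ + 4 * κ ^ 2) * Real.exp (4 * T)
  refine ⟨((2 + 2 * Real.exp (κ * T) ^ 2)
      * Real.exp (growthRate κ S (Real.exp (κ * T)) * T)).toNNReal,
    Real.toNNReal_pos.2 (by positivity), ?_⟩
  intro N hN xd xb vb ρ u h hρ hu h0 M hM x v y w hp t ht
  exact hp.discrepancy_le hT hN hM hκ h (hρ.mono hKκ) (hu.mono hKκ) (by positivity)
    (fun s hs => h.avg_leader_velocity_le hN hκ (hρ.mono hKκ)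
      (h0.trans (by exact_mod_cast hKκ)) hs) ht

end Stability

end

section

variable {d N M : ℕ} {P : Model d} {T : ℝ} {xd : Fin N → Vec d} {x v xb vb : Fin N → ℝ → Vec d}
  {y w : Fin M → ℝ → Vec d} {ρ : ℝ → Vec d → ℝ} {u : ℝ → Vec d → Vec d} {K κ : ℝ≥0}

/-! ### Observables controlled by the discrepancy -/

section Observables

/-- A bounded continuous function is Lipschitz up to an error that is small relative to
`1 + ‖b‖²`. -/
lemma exists_abs_sub_le (ψ : Vec d →ᵇ ℝ) {ε : ℝ} (hε : 0 < ε) :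
    ∃ A : ℝ≥0, 0 < A ∧ ∀ a b, |ψ a - ψ b| ≤ ε * (1 + ‖b‖ ^ 2) + A * ‖a - b‖ := by
  -- Beyond radius R the quadratic term alone dominates the oscillation 2‖ψ‖; inside, uniform
  -- continuity near a compact ball applies.
  obtain ⟨R, hR0, hR⟩ : ∃ R : ℝ, 0 ≤ R ∧ 2 * ‖ψ‖ ≤ ε * R ^ 2 := by
    refine ⟨Real.sqrt (2 * ‖ψ‖ / ε), Real.sqrt_nonneg _, ?_⟩
    rw [Real.sq_sqrt (by positivity)]
    exact (mul_div_cancel₀ _ hε.ne').ge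
  have h := (isCompact_closedBall (0 : Vec d) R).uniformContinuousAt_of_continuousAt ψ
    (fun _ _ => ψ.continuous.continuousAt) (Metric.dist_mem_uniformity hε)
  obtain ⟨δ, hδ, H⟩ := Metric.mem_uniformity_dist.1 h
  -- When ‖a - b‖ ≥ δ, the slope 2‖ψ‖/δ already pays for the oscillation; the 1 keeps the constant
  -- positive.
  refine ⟨⟨2 * ‖ψ‖ / δ + 1, by positivity⟩, ?_, fun a b => ?_⟩
  · change 0 < 2 * ‖ψ‖ / δ + 1
    positivity
  change _ ≤ _ + (2 * ‖ψ‖ / δ + 1) * ‖a - b‖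
  have hle : |ψ a - ψ b| ≤ 2 * ‖ψ‖ := by simpa [Real.dist_eq] using ψ.dist_le_two_norm a b
  have h0 : 0 ≤ (2 * ‖ψ‖ / δ + 1) * ‖a - b‖ := by positivity
  by_cases hb : ‖b‖ ≤ R
  · by_cases hab : ‖a - b‖ < δ
    · have h1 : dist (ψ b) (ψ a) < ε :=
        H (a := b) (b := a) (by rwa [dist_comm, dist_eq_norm]) (by simpa using hb)
      rw [dist_comm, Real.dist_eq] at h1
      nlinarith [sq_nonneg ‖b‖]
    · have h1 : 2 * ‖ψ‖ ≤ 2 * ‖ψ‖ / δ * ‖a - b‖ := by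
        rw [div_mul_eq_mul_div, le_div_iff₀ hδ]
        exact mul_le_mul_of_nonneg_left (not_lt.1 hab) (by positivity)
      nlinarith [sq_nonneg ‖b‖, norm_nonneg (a - b)]
  · have h1 : R ^ 2 ≤ ‖b‖ ^ 2 := pow_le_pow_left₀ hR0 (not_le.1 hb).le 2
    nlinarith

/-- The bound is integrated against an arbitrary coupling. Its quadratic term sees only the second
marginal, so no moment of the particle measure is required. -/
lemma enorm_integral_sub_le_of_boundedContinuous {μ ν : Measure (Vec d)} [IsFiniteMeasure μ]
    [IsFiniteMeasure ν] {ψ : Vec d →ᵇ ℝ} {ε : ℝ} {A : ℝ≥0} (hε : 0 ≤ ε) (hA : 0 < A)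
    (h : ∀ a b, |ψ a - ψ b| ≤ ε * (1 + ‖b‖ ^ 2) + A * ‖a - b‖) :
    ‖∫ z, ψ z ∂μ - ∫ z, ψ z ∂ν‖ₑ ≤
      ENNReal.ofReal ε * ∫⁻ z, ENNReal.ofReal (1 + ‖z‖ ^ 2) ∂ν + A * wasserstein1 μ ν := by
  rw [wasserstein1, ENNReal.mul_iInf_of_ne (by exact_mod_cast hA.ne') ENNReal.coe_ne_top,
    ENNReal.add_iInf]
  refine le_iInf fun ⟨γ, hγ1, hγ2⟩ => ?_
  subst hγ1 hγ2
  have hμ := ψ.integrable (γ.map Prod.fst)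
  have hν := ψ.integrable (γ.map Prod.snd)
  have h1 : Integrable (fun p : Vec d × Vec d => ψ p.1) γ :=
    (integrable_map_measure hμ.1 measurable_fst.aemeasurable).1 hμ
  have h2 : Integrable (fun p : Vec d × Vec d => ψ p.2) γ :=
    (integrable_map_measure hν.1 measurable_snd.aemeasurable).1 hν
  rw [integral_map measurable_fst.aemeasurable hμ.1, integral_map measurable_snd.aemeasurable hν.1,
    ← integral_sub h1 h2]
  refine (enorm_integral_le_lintegral_enorm _).trans ?_
  rw [lintegral_map (by fun_prop) measurable_snd, ← lintegral_const_mul _ measurable_edist,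
    ← lintegral_const_mul _ (by fun_prop), ← lintegral_add_left (by fun_prop)]
  refine lintegral_mono fun p => ?_
  rw [← ofReal_norm, Real.norm_eq_abs, ← ENNReal.ofReal_mul hε, edist_eq_enorm_sub, ← ofReal_norm,
    ← ENNReal.ofReal_coe_nnreal, ← ENNReal.ofReal_mul A.coe_nonneg,
    ← ENNReal.ofReal_add (by positivity) (by positivity)]
  exact ENNReal.ofReal_le_ofReal (h _ _)

/-- Observables that are Lipschitz on the graph of the fluid velocity and grow at most
quadratically away from it are controlled by the discrepancy. -/
lemma norm_integral_observable_sub_le {F : Type*} [NormedAddCommGroup F] [NormedSpace ℝ F]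
    [CompleteSpace F] (hM : 0 < M) (hN : 0 < N) {t : ℝ}
    (hρ : IsProbabilityMeasure (densityMeasure (ρ t))) {H : Vec d × Vec d → F} {A b : ℝ} {L : ℝ≥0}
    (hL : 0 < L) (hA : 0 ≤ A) (hlip : LipschitzWith L fun z => H (z, u t z))
    (hb : ∀ z, ‖H (z, u t z)‖ ≤ b)
    (hH : ∀ z c, ‖H (z, c) - H (z, u t z)‖ ≤ A * (‖c - u t z‖ + ‖c - u t z‖ ^ 2)) {ε : ℝ}
    (hε : 0 ≤ ε) (hD : discrepancy x v y w xb vb ρ u t ≤ ENNReal.ofReal (ε ^ 2)) :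
    ‖∫ p, H p ∂(followerMeasure y w t) - ∫ z, H (z, u t z) ∂(densityMeasure (ρ t))‖
      ≤ A * (ε + ε ^ 2) + L * ε := by
  rw [discrepancy_eq hN hM] at hD
  have hW : wasserstein1 (empirical fun i => y i t) (densityMeasure (ρ t)) ≤ ENNReal.ofReal ε := by
    have h1 := le_self_add.trans hD
    rw [ENNReal.ofReal_pow hε] at h1
    exact (ENNReal.pow_le_pow_left_iff two_ne_zero).1 h1
  have hE : (avg fun i => ‖w i t - u t (y i t)‖ ^ 2) ≤ ε ^ 2 := by
    have h1 := (ENNReal.ofReal_le_ofReal_iff (by positivity)).1 (le_add_self.trans hD)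
    have h2 : 0 ≤ avg fun i => ‖x i t - xb i t‖ ^ 2 := avg_nonneg fun i => by positivity
    have h3 : 0 ≤ avg fun i => ‖v i t - vb i t‖ ^ 2 := avg_nonneg fun i => by positivity
    linarith
  have hE1 : (avg fun i => ‖w i t - u t (y i t)‖) ≤ ε :=
    abs_le_of_sq_le_sq' ((avg_sq_le hM _).trans hE) hε |>.2
  have h1 := norm_integral_sub_le_of_wasserstein1_le hε hL hlip
    (integrable_empirical (fun i => y i t) _ hM)
    (Integrable.of_bound hlip.continuous.aestronglyMeasurable b (Eventually.of_forall hb)) hW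
  -- The intermediate quantity evaluates the observable at the particle positions but with the fluid
  -- velocity there.
  have h2 : ‖∫ p, H p ∂(followerMeasure y w t)
      - ∫ z, H (z, u t z) ∂(empirical fun i => y i t)‖ ≤ A * (ε + ε ^ 2) := by
    rw [followerMeasure, integral_empirical, integral_empirical, ← smul_sub,
      ← Finset.sum_sub_distrib]
    refine (norm_smul_sum_le_avg fun i => hH (y i t) (w i t)).trans ?_
    rw [avg_const_mul, avg_add]
    gcongr
  calc _ ≤ _ := norm_sub_le_norm_sub_add_norm_sub _ _ _
    _ ≤ _ := add_le_add h2 h1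

end Observables

/-! ### Uniform convergence of observables -/

section Convergence

variable {xs vs : ℕ → Fin N → ℝ → Vec d} {ys ws : (M : ℕ) → Fin M → ℝ → Vec d}

/-- The sequence of particle systems converges to the particle-fluid system, uniformly on
`[0, T]`. -/
def DiscrepancyTendsto (T : ℝ) (xs vs : ℕ → Fin N → ℝ → Vec d)
    (ys ws : (M : ℕ) → Fin M → ℝ → Vec d) (xb vb : Fin N → ℝ → Vec d) (ρ : ℝ → Vec d → ℝ)
    (u : ℝ → Vec d → Vec d) : Prop :=
  ∀ ε : ℝ, 0 < ε → ∀ᶠ M in atTop, 0 < M ∧ ∀ t ∈ Icc 0 T,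
    discrepancy (xs M) (vs M) (ys M) (ws M) xb vb ρ u t ≤ ENNReal.ofReal (ε ^ 2)

/-- The constants A and L are common to all times and all test functions in s, so the bound A(ε +
ε²) + Lε is uniform in both. -/
lemma DiscrepancyTendsto.tendstoUniformlyOn {F ι : Type*} [NormedAddCommGroup F]
    [NormedSpace ℝ F] [CompleteSpace F]
    (h : DiscrepancyTendsto T xs vs ys ws xb vb ρ u) (hN : 0 < N)
    (hρ : ∀ t ∈ Icc 0 T, IsProbabilityMeasure (densityMeasure (ρ t)))
    {H : ι → Vec d × Vec d → F} {s : Set ι} {A b : ℝ} {L : ℝ≥0} (hL : 0 < L) (hA : 0 ≤ A)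
    (hlip : ∀ t ∈ Icc 0 T, ∀ i ∈ s, LipschitzWith L fun z => H i (z, u t z))
    (hb : ∀ t ∈ Icc 0 T, ∀ i ∈ s, ∀ z, ‖H i (z, u t z)‖ ≤ b)
    (hH : ∀ t ∈ Icc 0 T, ∀ i ∈ s, ∀ z c,
      ‖H i (z, c) - H i (z, u t z)‖ ≤ A * (‖c - u t z‖ + ‖c - u t z‖ ^ 2)) :
    TendstoUniformlyOn (fun M (q : ℝ × ι) => ∫ p, H q.2 p ∂(followerMeasure (ys M) (ws M) q.1))
      (fun q => ∫ z, H q.2 (z, u q.1 z) ∂(densityMeasure (ρ q.1))) atTop (Icc 0 T ×ˢ s) := by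
  rw [Metric.tendstoUniformlyOn_iff]
  intro e he
  -- With ε ≤ 1 the error is at most (2A + L)ε; the extra 1 in the denominator makes the final
  -- inequality strict.
  set ε : ℝ := min 1 (e / (2 * A + L + 1)) with hε
  have hpos : 0 < 2 * A + L + 1 := by positivity
  have hε0 : 0 < ε := lt_min one_pos (by positivity)
  filter_upwards [h ε hε0] with M hM
  rintro ⟨t, i⟩ ⟨ht, hi⟩
  rw [dist_comm, dist_eq_norm]
  have h1 := norm_integral_observable_sub_le hM.1 hN (hρ t ht) hL hA (hlip t ht i hi)
    (hb t ht i hi) (hH t ht i hi) hε0.le (hM.2 t ht)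
  refine h1.trans_lt ?_
  have h2 : ε ^ 2 ≤ ε := by nlinarith [min_le_left 1 (e / (2 * A + L + 1))]
  have h3 : ε * (2 * A + L + 1) ≤ e := (le_div_iff₀ hpos).1 (min_le_right _ _)
  nlinarith

lemma DiscrepancyTendsto.tendstoUniformlyOn_boundedContinuous
    (h : DiscrepancyTendsto T xs vs ys ws xb vb ρ u)
    (hsol : IsParticleFluidSolution P T xd xb vb ρ u) (hK : DensityBound T K ρ)
    (ψ : Vec d →ᵇ ℝ) :
    TendstoUniformlyOn (fun M t => ∫ p, ψ p.1 ∂(followerMeasure (ys M) (ws M) t))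
      (fun t => ∫ z, ψ z ∂(densityMeasure (ρ t))) atTop (Icc 0 T) := by
  rw [Metric.tendstoUniformlyOn_iff]
  intro e he
  -- The moment term then costs at most e/2 and, with ε = e/(4A), the transport term e/4.
  obtain ⟨A, hA, hψ⟩ := exists_abs_sub_le ψ (ε := e / (2 * (K + 1))) (by positivity)
  set ε : ℝ := e / (4 * A) with hε
  have hε0 : 0 < ε := by positivity
  filter_upwards [h ε hε0] with M ⟨hM, hD⟩ t ht
  rw [dist_comm, dist_eq_norm]
  have := hsol.ρ_prob t ht
  have := isProbabilityMeasure_empirical (fun i => ys M i t) hM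
  have hW : wasserstein1 (empirical fun i => ys M i t) (densityMeasure (ρ t))
      ≤ ENNReal.ofReal ε := by
    have h1 := (le_self_add.trans le_self_add).trans (hD t ht)
    rw [map_fst_followerMeasure, ENNReal.ofReal_pow hε0.le] at h1
    exact (ENNReal.pow_le_pow_left_iff two_ne_zero).1 h1
  have h1 := enorm_integral_sub_le_of_boundedContinuous (μ := empirical fun i => ys M i t)
    (ν := densityMeasure (ρ t)) (by positivity) hA hψ
  have h2 := h1.trans (add_le_add (mul_le_mul_right (hsol.lintegral_moment_le hK ht) _)
    (mul_le_mul_right hW _))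
  rw [← ENNReal.ofReal_coe_nnreal, ← ENNReal.ofReal_coe_nnreal,
    ← ENNReal.ofReal_mul (by positivity), ← ENNReal.ofReal_mul A.coe_nonneg,
    ← ENNReal.ofReal_add (by positivity) (by positivity), ← ofReal_norm,
    ENNReal.ofReal_le_ofReal_iff (by positivity)] at h2
  rw [followerMeasure, integral_empirical]
  rw [integral_empirical] at h2
  refine h2.trans_lt ?_
  have h3 : e / (2 * (K + 1)) * K ≤ e / 2 := by
    rw [div_mul_eq_mul_div, div_le_div_iff₀ (by positivity) (by positivity)]
    nlinarith [K.coe_nonneg]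
  have h4 : A * ε = e / 4 := by
    rw [hε]
    have : (A : ℝ) ≠ 0 := by exact_mod_cast hA.ne'
    field_simp
  linarith

end Convergence

end

section

variable {d N : ℕ} {P : Model d} {T : ℝ} {xd : Fin N → Vec d} {xb vb : Fin N → ℝ → Vec d}
  {ρ : ℝ → Vec d → ℝ} {u : ℝ → Vec d → Vec d} {K κ : ℝ≥0}
  {xs vs : ℕ → Fin N → ℝ → Vec d} {ys ws : (M : ℕ) → Fin M → ℝ → Vec d}

/-! ### Momentum, energy tensor and kinetic measure -/

section Convergence

lemma DiscrepancyTendsto.tendstoUniformlyOn_momentum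
    (h : DiscrepancyTendsto T xs vs ys ws xb vb ρ u) (hN : 0 < N)
    (hρ : ∀ t ∈ Icc 0 T, IsProbabilityMeasure (densityMeasure (ρ t)))
    (hu : VelocityBound T κ u) (hκ : 1 ≤ κ) :
    TendstoUniformlyOn
      (fun M (q : ℝ × (Vec d → ℝ)) => ∫ p, q.2 p.1 • p.2 ∂(followerMeasure (ys M) (ws M) q.1))
      (fun q => ∫ z, q.2 z • u q.1 z ∂(densityMeasure (ρ q.1)))
      atTop (Icc 0 T ×ˢ lipBall (Vec d)) := by
  have hκ0 : 0 < κ := one_pos.trans_le hκ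
  -- In L = 2κ one κ is the Lipschitz constant of u, the other its supremum against the Lipschitz
  -- constant 1 of ψ.
  refine h.tendstoUniformlyOn hN hρ (s := lipBall (Vec d))
    (H := fun (ψ : Vec d → ℝ) p => ψ p.1 • p.2) (A := 1) (b := κ) (L := 2 * κ)
    (by positivity) zero_le_one (fun t ht ψ hψ => ?_) (fun t ht ψ hψ z => ?_)
    (fun t ht ψ hψ z c => ?_)
  · refine LipschitzWith.of_dist_le_mul fun a b => ?_
    rw [dist_eq_norm, dist_eq_norm]
    have h1 : ψ a • u t a - ψ b • u t b = ψ a • (u t a - u t b) + (ψ a - ψ b) • u t b := by module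
    have h2 : ‖ψ a • (u t a - u t b)‖ ≤ 1 * (κ * ‖a - b‖) := by
      rw [norm_smul]
      exact mul_le_mul (hψ.1 a) ((hu t ht).2.norm_sub_le a b) (norm_nonneg _) zero_le_one
    have h3 : ‖(ψ a - ψ b) • u t b‖ ≤ ((1 : ℝ≥0) * ‖a - b‖) * κ := by
      rw [norm_smul]
      exact mul_le_mul (hψ.2.norm_sub_le a b) ((hu t ht).1 b) (norm_nonneg _) (by positivity)
    rw [h1]
    refine (norm_add_le _ _).trans ?_
    push_cast at h3 ⊢
    linarith
  · rw [norm_smul]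
    exact (mul_le_of_le_one_left (norm_nonneg _) (hψ.1 z)).trans ((hu t ht).1 z)
  · rw [← smul_sub, norm_smul, one_mul]
    refine (mul_le_of_le_one_left (norm_nonneg _) (hψ.1 z)).trans ?_
    exact le_add_of_nonneg_right (by positivity)

lemma DiscrepancyTendsto.tendstoUniformlyOn_energy
    (h : DiscrepancyTendsto T xs vs ys ws xb vb ρ u) (hN : 0 < N)
    (hρ : ∀ t ∈ Icc 0 T, IsProbabilityMeasure (densityMeasure (ρ t)))
    (hu : VelocityBound T κ u) (hκ : 1 ≤ κ) (k l : Fin d) :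
    TendstoUniformlyOn
      (fun M (q : ℝ × (Vec d → ℝ)) =>
        ∫ p, q.2 p.1 * (p.2 k * p.2 l) ∂(followerMeasure (ys M) (ws M) q.1))
      (fun q => ∫ z, q.2 z * (u q.1 z k * u q.1 z l) ∂(densityMeasure (ρ q.1)))
      atTop (Icc 0 T ×ˢ lipBall (Vec d)) := by
  have hκ0 : 0 < κ := one_pos.trans_le hκ
  have hco : ∀ (a : Vec d) (j : Fin d), |a j| ≤ ‖a‖ := fun a j => PiLp.norm_apply_le a j
  have hprod : ∀ t ∈ Icc 0 T, ∀ z, |u t z k * u t z l| ≤ κ * κ := fun t ht z => by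
    rw [abs_mul]
    exact mul_le_mul ((hco _ k).trans ((hu t ht).1 z)) ((hco _ l).trans ((hu t ht).1 z))
      (abs_nonneg _) κ.coe_nonneg
  -- With e = c - u, the difference c_k c_l - u_k u_l is e_k e_l + e_k u_l + u_k e_l, of size ‖e‖² +
  -- 2κ‖e‖; hence A = 1 + 2κ. The three terms of the product rule give L = 3κ².
  refine h.tendstoUniformlyOn hN hρ (s := lipBall (Vec d))
    (H := fun (ψ : Vec d → ℝ) p => ψ p.1 * (p.2 k * p.2 l)) (A := 1 + 2 * κ)
    (b := κ * κ) (L := 3 * κ ^ 2) (by positivity) (by positivity) (fun t ht ψ hψ => ?_)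
    (fun t ht ψ hψ z => ?_) (fun t ht ψ hψ z c => ?_)
  · refine LipschitzWith.of_dist_le_mul fun a b => ?_
    rw [Real.dist_eq, dist_eq_norm]
    have hL := (hu t ht).2.norm_sub_le a b
    have h1 : ψ a * (u t a k * u t a l) - ψ b * (u t b k * u t b l)
        = ψ a * (u t a k * (u t a - u t b) l) + ψ a * ((u t a - u t b) k * u t b l)
          + (ψ a - ψ b) * (u t b k * u t b l) := by
      simp only [PiLp.sub_apply]
      ring
    have h2 : |ψ a * (u t a k * (u t a - u t b) l)| ≤ 1 * (κ * (κ * ‖a - b‖)) := by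
      rw [abs_mul, abs_mul]
      exact mul_le_mul (hψ.1 a) (mul_le_mul ((hco _ k).trans ((hu t ht).1 a))
        ((hco _ l).trans hL) (abs_nonneg _) κ.coe_nonneg) (by positivity) zero_le_one
    have h3 : |ψ a * ((u t a - u t b) k * u t b l)| ≤ 1 * ((κ * ‖a - b‖) * κ) := by
      rw [abs_mul, abs_mul]
      exact mul_le_mul (hψ.1 a) (mul_le_mul ((hco _ k).trans hL)
        ((hco _ l).trans ((hu t ht).1 b)) (abs_nonneg _) (by positivity)) (by positivity)
        zero_le_one
    have h4 : |(ψ a - ψ b) * (u t b k * u t b l)| ≤ ((1 : ℝ≥0) * ‖a - b‖) * (κ * κ) := by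
      rw [abs_mul]
      exact mul_le_mul (hψ.2.norm_sub_le a b) (hprod t ht b) (abs_nonneg _) (by positivity)
    rw [h1]
    refine (abs_add_three _ _ _).trans ?_
    push_cast at h4 ⊢
    linarith
  · rw [Real.norm_eq_abs, abs_mul]
    exact (mul_le_of_le_one_left (abs_nonneg _) (hψ.1 z)).trans (hprod t ht z)
  · have h1 : ψ z * (c k * c l) - ψ z * (u t z k * u t z l)
        = ψ z * ((c - u t z) k * (c - u t z) l + (c - u t z) k * u t z l
          + u t z k * (c - u t z) l) := by
      simp only [PiLp.sub_apply]
      ring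
    have hz := (hu t ht).1 z
    set e := c - u t z with he
    have h2 : |e k * e l| ≤ ‖e‖ * ‖e‖ := by
      rw [abs_mul]
      exact mul_le_mul (hco _ k) (hco _ l) (abs_nonneg _) (norm_nonneg _)
    have h3 : |e k * u t z l| ≤ ‖e‖ * κ := by
      rw [abs_mul]
      exact mul_le_mul (hco _ k) ((hco _ l).trans hz) (abs_nonneg _) (norm_nonneg _)
    have h4 : |u t z k * e l| ≤ κ * ‖e‖ := by
      rw [abs_mul]
      exact mul_le_mul ((hco _ k).trans hz) (hco _ l) (abs_nonneg _) κ.coe_nonneg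
    dsimp only
    rw [h1, Real.norm_eq_abs, abs_mul]
    refine (mul_le_of_le_one_left (abs_nonneg _) (hψ.1 z)).trans ?_
    refine (abs_add_three _ _ _).trans ?_
    have h5 : 0 ≤ κ * ‖e‖ ^ 2 := by positivity
    nlinarith [norm_nonneg e]

lemma DiscrepancyTendsto.tendstoUniformlyOn_kinetic
    (h : DiscrepancyTendsto T xs vs ys ws xb vb ρ u) (hN : 0 < N)
    (hρ : ∀ t ∈ Icc 0 T, IsProbabilityMeasure (densityMeasure (ρ t)))
    (hu : VelocityBound T κ u) (hκ : 1 ≤ κ) :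
    TendstoUniformlyOn
      (fun M (q : ℝ × (Vec d × Vec d → ℝ)) => ∫ p, q.2 p ∂(followerMeasure (ys M) (ws M) q.1))
      (fun q => ∫ p, q.2 p ∂((densityMeasure (ρ q.1)).map fun z => (z, u q.1 z)))
      atTop (Icc 0 T ×ˢ lipBall (Vec d × Vec d)) := by
  have hκ0 : 0 < κ := one_pos.trans_le hκ
  have key := h.tendstoUniformlyOn hN hρ (s := lipBall (Vec d × Vec d)) (H := fun ψ p => ψ p)
    (A := 1) (b := 1) (L := κ) hκ0 zero_le_one (fun t ht ψ hψ => ?_) (fun t ht ψ hψ z => hψ.1 _)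
    (fun t ht ψ hψ z c => ?_)
  · refine key.congr_right ?_
    rintro ⟨t, ψ⟩ ⟨ht, hψ⟩
    have hm : Measurable fun z => (z, u t z) :=
      measurable_id.prodMk (hu t ht).2.continuous.measurable
    exact (integral_map hm.aemeasurable hψ.2.continuous.aestronglyMeasurable).symm
  -- In the maximum metric the graph map z ↦ (z, u(t, z)) is κ-Lipschitz, because κ ≥ 1.
  · refine LipschitzWith.of_dist_le_mul fun a b => (hψ.2.dist_le_mul _ _).trans ?_
    rw [NNReal.coe_one, one_mul, Prod.dist_eq]
    exact max_le (le_mul_of_one_le_left dist_nonneg (by exact_mod_cast hκ))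
      ((hu t ht).2.dist_le_mul a b)
  · rw [one_mul]
    have h1 := hψ.2.dist_le_mul (z, c) (z, u t z)
    rw [Prod.dist_eq, dist_self, NNReal.coe_one, one_mul, max_eq_right dist_nonneg,
      dist_eq_norm, dist_eq_norm] at h1
    exact h1.trans (le_add_of_nonneg_right (by positivity))

end Convergence

end

end LeaderFollower

end

/-! ### The main theorem -/

open LeaderFollower in
theorem theorem2p1 {d : ℕ} (T : ℝ) (hT : 0 < T) (P : Model d) (hP : P.Admissible) :
    -- quantitative stability estimate
    (∀ K : ℝ≥0, ∃ C : ℝ≥0, 0 < C ∧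
      ∀ (N : ℕ), 0 < N → ∀ (xd : Fin N → Vec d) (xb vb : Fin N → ℝ → Vec d)
        (ρ : ℝ → Vec d → ℝ) (u : ℝ → Vec d → Vec d),
        IsParticleFluidSolution P T xd xb vb ρ u →
        DensityBound T K ρ → VelocityBound T K u →
        (N : ℝ)⁻¹ * ∑ i, (‖xd i‖ ^ 2 + ‖xb i 0‖ ^ 2 + ‖vb i 0‖ ^ 2) ≤ K →
        ∀ (M : ℕ), 0 < M → ∀ (x v : Fin N → ℝ → Vec d) (y w : Fin M → ℝ → Vec d),
          IsParticleSolution P T xd x v y w →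
          ∀ t ∈ Icc 0 T,
            discrepancy x v y w xb vb ρ u t ≤ C * discrepancy x v y w xb vb ρ u 0) ∧
    -- convergence as the number of followers tends to infinity
    (∀ (N : ℕ), 0 < N → ∀ (xd : Fin N → Vec d) (xb vb : Fin N → ℝ → Vec d)
      (ρ : ℝ → Vec d → ℝ) (u : ℝ → Vec d → Vec d),
      IsParticleFluidSolution P T xd xb vb ρ u →
      (∃ K, DensityBound T K ρ) → (∃ K, VelocityBound T K u) →
      ∀ (x v : ℕ → Fin N → ℝ → Vec d) (y w : (M : ℕ) → Fin M → ℝ → Vec d),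
        (∀ M, 0 < M → IsParticleSolution P T xd (x M) (v M) (y M) (w M)) →
        Tendsto (fun M => discrepancy (x M) (v M) (y M) (w M) xb vb ρ u 0) atTop (𝓝 0) →
        -- leaders
        Tendsto (fun M => ⨆ t ∈ Icc 0 T, leaderDiscrepancy (x M) (v M) xb vb t) atTop (𝓝 0) ∧
        -- follower density
        (∀ ψ : Vec d →ᵇ ℝ, TendstoUniformlyOn
          (fun M t => ∫ p, ψ p.1 ∂(followerMeasure (y M) (w M) t))
          (fun t => ∫ z, ψ z ∂(densityMeasure (ρ t))) atTop (Icc 0 T)) ∧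
        -- follower momentum
        TendstoUniformlyOn
          (fun M (q : ℝ × (Vec d → ℝ)) =>
            ∫ p, q.2 p.1 • p.2 ∂(followerMeasure (y M) (w M) q.1))
          (fun q => ∫ z, q.2 z • u q.1 z ∂(densityMeasure (ρ q.1)))
          atTop (Icc 0 T ×ˢ lipBall (Vec d)) ∧
        -- follower energy tensor, entry by entry
        (∀ k l : Fin d, TendstoUniformlyOn
          (fun M (q : ℝ × (Vec d → ℝ)) =>
            ∫ p, q.2 p.1 * (p.2 k * p.2 l) ∂(followerMeasure (y M) (w M) q.1))
          (fun q => ∫ z, q.2 z * (u q.1 z k * u q.1 z l) ∂(densityMeasure (ρ q.1)))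
          atTop (Icc 0 T ×ˢ lipBall (Vec d))) ∧
        -- follower kinetic measure; the limit is `ρ ⊗ δ_u`, the image of `ρ` on the graph of `u`
        TendstoUniformlyOn
          (fun M (q : ℝ × (Vec d × Vec d → ℝ)) =>
            ∫ p, q.2 p ∂(followerMeasure (y M) (w M) q.1))
          (fun q => ∫ p, q.2 p ∂((densityMeasure (ρ q.1)).map fun z => (z, u q.1 z)))
          atTop (Icc 0 T ×ˢ lipBall (Vec d × Vec d))) := by
  refine ⟨fun K => hP.exists_discrepancy_le hT K, ?_⟩
  rintro N hN xd xb vb ρ u hsol ⟨K₁, hK₁⟩ ⟨K₂, hK₂⟩ x v y w hp hD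
  -- For a fixed solution the bound on targets and initial leader data is automatic, so the first
  -- part applies with one K for all M.
  obtain ⟨K₃, hK₃⟩ : ∃ K₃ : ℝ≥0,
      (N : ℝ)⁻¹ * ∑ i, (‖xd i‖ ^ 2 + ‖xb i 0‖ ^ 2 + ‖vb i 0‖ ^ 2) ≤ K₃ :=
    ⟨_, Real.le_coe_toNNReal _⟩
  let K : ℝ≥0 := 1 + K₁ + K₂ + K₃
  have hK1 : 1 ≤ K := le_self_add.trans (le_self_add.trans le_self_add)
  have hKK₁ : K₁ ≤ K := le_add_self.trans (le_self_add.trans le_self_add)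
  have hKK₂ : K₂ ≤ K := le_add_self.trans le_self_add
  have hKK₃ : K₃ ≤ K := le_add_self
  have hu := hK₂.mono hKK₂
  obtain ⟨C, hC, hstab⟩ := hP.exists_discrepancy_le hT K
  have hest : ∀ M, 0 < M → ∀ t ∈ Icc 0 T, discrepancy (x M) (v M) (y M) (w M) xb vb ρ u t
      ≤ C * discrepancy (x M) (v M) (y M) (w M) xb vb ρ u 0 := fun M hM t ht =>
    hstab N hN xd xb vb ρ u hsol (hK₁.mono hKK₁) hu (hK₃.trans (by exact_mod_cast hKK₃)) M hM
      (x M) (v M) (y M) (w M) (hp M hM) t ht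
  have hCD : Tendsto (fun M => C * discrepancy (x M) (v M) (y M) (w M) xb vb ρ u 0) atTop
      (𝓝 0) := by
    simpa using ENNReal.Tendsto.const_mul hD (Or.inr ENNReal.coe_ne_top)
  have hconv : DiscrepancyTendsto T x v y w xb vb ρ u := by
    intro ε hε
    filter_upwards [eventually_gt_atTop 0,
      hCD.eventually_le_const (ENNReal.ofReal_pos.2 (pow_pos hε 2))] with M hM hMε
    exact ⟨hM, fun t ht => (hest M hM t ht).trans hMε⟩
  refine ⟨?_, hconv.tendstoUniformlyOn_boundedContinuous hsol hK₁,
    hconv.tendstoUniformlyOn_momentum hN hsol.ρ_prob hu hK1,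
    hconv.tendstoUniformlyOn_energy hN hsol.ρ_prob hu hK1,
    hconv.tendstoUniformlyOn_kinetic hN hsol.ρ_prob hu hK1⟩
  -- The leader discrepancy is a summand of D. The bound is only eventual because no solution is
  -- assumed for M = 0.
  refine tendsto_of_tendsto_of_tendsto_of_le_of_le' tendsto_const_nhds hCD
    (Eventually.of_forall fun M => zero_le) ?_
  filter_upwards [eventually_gt_atTop 0] with M hM
  exact iSup₂_le fun t ht => le_add_self.trans (hest M hM t ht)
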